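/- Let $1\le p<n$, $m=n-p$, and let $x_1,\dots,x_n\in\mathbb R^p$ be such that $\Sigma_n=n^{-1}\sum_i x_ix_i^{\rm t}$ has full rank. Let $y_i=x_i^{\rm t}\beta+\varepsilon_i$ with $\varepsilon_1,\dots,\varepsilon_n$ i.i.d. ${\rm N}(0,\sigma^2)$, $\beta\in\mathbb R^p$, $\sigma>0$, and let $S\subsetneq\{1,\dots,p\}$. Let $\hat\beta=\Sigma_n^{-1}n^{-1}\sum_i x_iy_i$, $\hat\sigma^2=m^{-1}\sum_i(y_i-x_i^{\rm t}\hat\beta)^2$, let $\hat\beta_S=\Sigma_{n,S}^{-1}n^{-1}\sum_i x_{i,S}y_i$, with $\Sigma_{n,S}=n^{-1}\sum_i x_{i,S}x_{i,S}^{\rm t}$, be the least squares estimator in the submodel using only the covariates in $S$, and let $Q_S$ be the $S^c\times S^c$ block of $\Sigma_n^{-1}$. Put $$\gamma_S=n\beta_{S^c}^{\rm t}Q_S^{-1}\beta_{S^c}/\sigma^2,\qquad \tilde\gamma_S=n\hat\beta_{S^c}^{\rm t}Q_S^{-1}\hat\beta_{S^c}/\hat\sigma^2,$$ where $\hat\beta_{S^c}$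 is the $S^c$-part of the wide model estimator $\hat\beta$, and let $${\rm rr}_S=\frac{{\rm risk}_S}{{\rm risk}_{\rm wide}}=\frac{{\rm E}\sum_i n^{-1}(x_{i,S}^{\rm t}\hat\beta_S-x_i^{\rm t}\beta)^2}{{\rm E}\sum_i n^{-1}(x_i^{\rm t}\hat\beta-x_i^{\rm t}\beta)^2}$$ be the overall relative risk of $S$ against the wide model, with equal weight $1/n$ on all observed covariate vectors. Let $F_{k,m}(\lambda)$ be the noncentral $F$ distribution, i.e. the law of $(V/k)/(W/m)$ with independent $V\sim\chi^2_k(\lambda)$, $W\sim\chi^2_m$, where $\chi^2_k(\lambda)$ is the law of the sum of squares of $k$ independent unit-variance normals whose squared means sum to $\lambda$; write $F_{k,m}(\cdot,\lambda)$ for its cumulative distribution function and $F_{k,m}(\cdot)=F_{k,m}(\cdot,0)$. Then, for all $\beta$ and all $\sigma>0$: (a) $\tilde\gamma_S\sim(p-|S|)\,F_{p-|S|,m}(\gamma_S)$. (b) Both risks are finite, ${\rm risk}_{\rm wide}>0$, and ${\rm rr}_S=(|S|+\gamma_S)/p\ge|S|/p$. (c) For observed data with statistic value $\tilde\gamma_{S,\rm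 obs}$, put $$C_S^*(r)=1-F_{p-|S|,m}\Bigl(\frac{\tilde\gamma_{S,\rm obs}}{p-|S|},\;p\,r-|S|\Bigr)\quad\text{for } r\ge|S|/p,$$ and $C^*_S(r)=0$ for $r<|S|/p$. Then $C_S^*({\rm rr}_S)={\rm pr}_{\beta,\sigma}\{(|S|+\tilde\gamma_S)/p\ge(|S|+\tilde\gamma_{S,\rm obs})/p\}$. (d) $C_S^*$ is an exact confidence distribution for ${\rm rr}_S$: for all observed data, $C^*_S$ is the cumulative distribution function of a probability measure on $\mathbb R$; and with random data, ${\rm pr}_{\beta,\sigma}\{C_S^*({\rm rr}_S)\le\alpha\}=\alpha$ for all $\alpha\in(0,1)$. (e) For all observed data this probability measure has a point mass at $|S|/p$, of size $1-F_{p-|S|,m}(\tilde\gamma_{S,\rm obs}/(p-|S|))>0$. (In the null event $\hat\sigma^2=0$, $\tilde\gamma_S$ is read as $0$.) -/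

import Mathlib

open MeasureTheory ProbabilityTheory Matrix

namespace Afric

noncomputable section

/-! ### Chi-squared and F distributions -/

/-- The chi-squared distribution with `m` degrees of freedom: the law of the sum of squares of
`m` independent standard normal variables. -/
def chiSq (m : ℕ) : Measure ℝ :=
  (Measure.pi fun _ : Fin m => gaussianReal 0 1).map fun z => ∑ i, z i ^ 2

/-- The noncentral chi-squared distribution with `k ≥ 1` degrees of freedom and excentre
(noncentrality) parameter `l ≥ 0`: the law of the sum of squares of `k` independent unit-variance
normal variables with means `(√l, 0, …, 0)`, a mean vector with squared length `l`. -/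
def noncentralChiSq (k : ℕ) (l : ℝ) : Measure ℝ :=
  (Measure.pi fun i : Fin k => gaussianReal (if (i : ℕ) = 0 then √l else 0) 1).map
    fun z => ∑ i, z i ^ 2

/-- The (central) F distribution with degrees of freedom `(k, m)`: the law of
`(V / k) / (W / m)` with `V ∼ χ²_k` and `W ∼ χ²_m` independent. -/
def centralF (k m : ℕ) : Measure ℝ :=
  ((chiSq k).prod (chiSq m)).map fun w => (w.1 / k) / (w.2 / m)

/-- The noncentral F distribution with degrees of freedom `(k, m)` and excentre parameter `l`:
the law of `(V / k) / (W / m)` with `V ∼ χ²_k(l)` and `W ∼ χ²_m` independent. -/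
def noncentralF (k m : ℕ) (l : ℝ) : Measure ℝ :=
  ((noncentralChiSq k l).prod (chiSq m)).map fun w => (w.1 / k) / (w.2 / m)

/-! ### The wide linear regression model -/

variable {n p : ℕ}

/-- The law of the data `y = X β + ε`, with `ε_1, …, ε_n` i.i.d. `N(0, σ²)`; row `i` of `X` is the
covariate vector `x_i`. -/
def modelLaw (X : Matrix (Fin n) (Fin p) ℝ) (β : Fin p → ℝ) (σ : ℝ) : Measure (Fin n → ℝ) :=
  (Measure.pi fun _ : Fin n => gaussianReal 0 (Real.toNNReal (σ ^ 2))).map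
    fun ε i => (X *ᵥ β) i + ε i

/-- `Σ_n = n⁻¹ ∑ x_i x_iᵗ`. -/
def sigmaN (X : Matrix (Fin n) (Fin p) ℝ) : Matrix (Fin p) (Fin p) ℝ :=
  (n : ℝ)⁻¹ • ∑ i, vecMulVec (X i) (X i)

/-- The least squares estimator in the wide model, `Σ_n⁻¹ n⁻¹ ∑ x_i y_i`. -/
def betaWide (X : Matrix (Fin n) (Fin p) ℝ) (y : Fin n → ℝ) : Fin p → ℝ :=
  (sigmaN X)⁻¹ *ᵥ ((n : ℝ)⁻¹ • ∑ i, y i • X i)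

/-- The unbiased residual variance estimator `(n - p)⁻¹ ∑ (y_i - x_iᵗ β̂)²`. -/
def sigmaHatSq (X : Matrix (Fin n) (Fin p) ℝ) (y : Fin n → ℝ) : ℝ :=
  ((n : ℝ) - p)⁻¹ * ∑ i, (y i - X i ⬝ᵥ betaWide X y) ^ 2

/-! ### Submodels -/

/-- `u_S`, the subvector of `u` with index in `S`. -/
def sub (S : Finset (Fin p)) (u : Fin p → ℝ) : {j // j ∈ S} → ℝ := fun j => u j

/-- `u_{Sᶜ}`, the subvector of `u` with index outside `S`. -/
def subCompl (S : Finset (Fin p)) (u : Fin p → ℝ) : {j // j ∉ S} → ℝ := fun j => u j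

/-- `Σ_{n,S} = n⁻¹ ∑ x_{i,S} x_{i,S}ᵗ`. -/
def sigmaNS (X : Matrix (Fin n) (Fin p) ℝ) (S : Finset (Fin p)) :
    Matrix {j // j ∈ S} {j // j ∈ S} ℝ :=
  (n : ℝ)⁻¹ • ∑ i, vecMulVec (sub S (X i)) (sub S (X i))

/-- The least squares estimator in submodel `S`, `Σ_{n,S}⁻¹ n⁻¹ ∑ x_{i,S} y_i`. -/
def betaSub (X : Matrix (Fin n) (Fin p) ℝ) (S : Finset (Fin p)) (y : Fin n → ℝ) :
    {j // j ∈ S} → ℝ :=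
  (sigmaNS X S)⁻¹ *ᵥ ((n : ℝ)⁻¹ • ∑ i, y i • sub S (X i))

/-- `Q_S`, the `Sᶜ × Sᶜ` block of `Σ_n⁻¹`. -/
def QS (X : Matrix (Fin n) (Fin p) ℝ) (S : Finset (Fin p)) :
    Matrix {j // j ∉ S} {j // j ∉ S} ℝ :=
  (sigmaN X)⁻¹.submatrix Subtype.val Subtype.val

/-- `γ_S = n β_{Sᶜ}ᵗ Q_S⁻¹ β_{Sᶜ} / σ²`. -/
def gammaS (X : Matrix (Fin n) (Fin p) ℝ) (S : Finset (Fin p)) (β : Fin p → ℝ) (σ : ℝ) : ℝ :=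
  n * (subCompl S β ⬝ᵥ ((QS X S)⁻¹ *ᵥ subCompl S β)) / σ ^ 2

/-- The statistic `γ̃_S = n β̂_{Sᶜ}ᵗ Q_S⁻¹ β̂_{Sᶜ} / σ̂²`, with `β̂` the wide model estimator. -/
def gammaTilde (X : Matrix (Fin n) (Fin p) ℝ) (S : Finset (Fin p)) (y : Fin n → ℝ) : ℝ :=
  n * (subCompl S (betaWide X y) ⬝ᵥ ((QS X S)⁻¹ *ᵥ subCompl S (betaWide X y))) / sigmaHatSq X y

/-! ### Overall risks, all observed covariate vectors having weight `1/n` -/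

/-- The loss `∑ n⁻¹ (x_{i,S}ᵗ β̂_S - x_iᵗ β)²` of submodel `S`. -/
def lossSub (X : Matrix (Fin n) (Fin p) ℝ) (S : Finset (Fin p)) (β : Fin p → ℝ)
    (y : Fin n → ℝ) : ℝ :=
  ∑ i, (n : ℝ)⁻¹ * (sub S (X i) ⬝ᵥ betaSub X S y - X i ⬝ᵥ β) ^ 2

/-- The loss `∑ n⁻¹ (x_iᵗ β̂ - x_iᵗ β)²` of the wide model. -/
def lossWide (X : Matrix (Fin n) (Fin p) ℝ) (β : Fin p → ℝ) (y : Fin n → ℝ) : ℝ :=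
  ∑ i, (n : ℝ)⁻¹ * (X i ⬝ᵥ betaWide X y - X i ⬝ᵥ β) ^ 2

def riskSub (X : Matrix (Fin n) (Fin p) ℝ) (S : Finset (Fin p)) (β : Fin p → ℝ) (σ : ℝ) : ℝ :=
  ∫ y, lossSub X S β y ∂modelLaw X β σ

def riskWide (X : Matrix (Fin n) (Fin p) ℝ) (β : Fin p → ℝ) (σ : ℝ) : ℝ :=
  ∫ y, lossWide X β y ∂modelLaw X β σ

/-- The overall relative risk `rr_S = risk_S / risk_wide`. -/
def relRisk (X : Matrix (Fin n) (Fin p) ℝ) (S : Finset (Fin p)) (β : Fin p → ℝ) (σ : ℝ) : ℝ :=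
  riskSub X S β σ / riskWide X β σ

/-! ### Confidence distributions -/

/-- `C` is an exact confidence distribution for the parameter `ψ θ`, in the family of models
`law θ` with `θ ∈ Θ`: for all data, `C y` is the cumulative distribution function of a probability
measure on the line, and `pr_θ {C(ψ(θ), data) ≤ α} = α` for all `θ` and all `α ∈ (0, 1)`. -/
structure IsExactConfidenceDistribution {T Y : Type*} [MeasurableSpace Y] (Θ : Set T)
    (law : T → Measure Y) (ψ : T → ℝ) (C : Y → ℝ → ℝ) : Prop where
  isCdf : ∀ y, ∃ μ : Measure ℝ, IsProbabilityMeasure μ ∧ ∀ r, cdf μ r = C y r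
  measurable : ∀ r, Measurable fun y => C y r
  exact : ∀ θ ∈ Θ, ∀ α ∈ Set.Ioo (0 : ℝ) 1, law θ {y | C y (ψ θ) ≤ α} = ENNReal.ofReal α

/-- `C*_S(r) = 1 - F_{p-|S|,m}(γ̃_{S,obs} / (p - |S|), p r - |S|)` for `r ≥ |S|/p`, and zero below
the smallest possible value `|S|/p` of the relative risk. -/
def confDist (X : Matrix (Fin n) (Fin p) ℝ) (S : Finset (Fin p)) (yobs : Fin n → ℝ) (r : ℝ) : ℝ :=
  open Classical in
  if (S.card : ℝ) / p ≤ r then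
    1 - cdf (noncentralF (p - S.card) (n - p) (p * r - S.card))
      (gammaTilde X S yobs / ((p : ℝ) - S.card))
  else 0

end

end Afric

namespace Afric

open Filter Set Topology

/-! Let H and H_S be the projections on the column spaces of X and of its columns in S. These spaces
are nested, so H - H_S and 1 - H are orthogonal projections of ranks p - |S| and m = n - p, with
product zero. A Schur complement identity, `subCompl_quadForm_eq`, turns quadratic forms in Q_S⁻¹
into quadratic forms in 1 - H_S. Thus γ̃_S is |(H - H_S)y|² divided by |(1 - H)y|²/m, and σ²γ_S =
|(1 - H_S)Xβ|². Since 1 - H kills the mean Xβ, a rotation (`measurePreserving_quadForms`) gives the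
F law.

The same γ_S is the squared bias in the risk: by `sq_dist_projection` the loss of S is, up to the
factor 1/n, a variance part with mean σ²|S| plus the constant σ²γ_S, while the wide model has risk
σ²p/n. Hence p·rr_S - |S| = γ_S, and C*_S at the true relative risk is an upper tail of the exact
law of the statistic. That law has no atoms, so the probability integral transform
(`measure_le_cdf`) gives exactness.

That C*_S is a distribution function for every data set depends on how the F distribution function
varies with its excentre l. By `noncentralF_succ`, l only shifts one standard normal Z by √l. Given
the other variables, the probability of (Z + √l)² ≤ t is continuous in l and decreases to zero
(`shiftedSqProb_anti`, `tendsto_shiftedSqProb`); integration preserves this. The jump at |S|/p is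
the value of C*_S there, positive because an F law charges every upper half-line. -/

/-! ### Noncentral chi-squared and F laws: representation, no atoms, unbounded upper tail -/

lemma measurable_sum_sq (ι : Type*) [Fintype ι] :
    Measurable fun z : ι → ℝ => ∑ i, z i ^ 2 :=
  Finset.measurable_sum _ fun i _ => (measurable_pi_apply i).pow_const 2

instance (m : ℕ) : IsProbabilityMeasure (chiSq m) :=
  Measure.isProbabilityMeasure_map (measurable_sum_sq _).aemeasurable

instance (k : ℕ) (l : ℝ) : IsProbabilityMeasure (noncentralChiSq k l) :=
  Measure.isProbabilityMeasure_map (measurable_sum_sq _).aemeasurable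

instance (k m : ℕ) (l : ℝ) : IsProbabilityMeasure (noncentralF k m l) :=
  Measure.isProbabilityMeasure_map (by fun_prop)

lemma noncentralChiSq_zero (k : ℕ) : noncentralChiSq k 0 = chiSq k := by
  simp [noncentralChiSq, chiSq]

lemma noncentralF_zero (k m : ℕ) : noncentralF k m 0 = centralF k m := by
  simp [noncentralF, centralF, noncentralChiSq_zero]

/-- Coordinate 0 carries the whole mean, so splitting it off leaves a central chi-squared variable.
-/
lemma measurePreserving_add_sq_add (k : ℕ) (l : ℝ) :
    MeasurePreserving (fun w : ℝ × ℝ => (w.1 + √l) ^ 2 + w.2)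
      ((gaussianReal 0 1).prod (chiSq k)) (noncentralChiSq (k + 1) l) := by
  have h1 : MeasurePreserving (fun z : ℝ => z + √l) (gaussianReal 0 1) (gaussianReal (√l) 1) :=
    ⟨by fun_prop, by rw [gaussianReal_map_add_const, zero_add]⟩
  have h2 : MeasurePreserving (fun z : Fin k → ℝ => ∑ i, z i ^ 2)
      (Measure.pi fun _ : Fin k => gaussianReal 0 1) (chiSq k) := ⟨measurable_sum_sq _, rfl⟩
  have h3 := (measurePreserving_piFinSuccAbove
    (fun i : Fin (k + 1) => gaussianReal (if (i : ℕ) = 0 then √l else 0) 1) 0).symm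
  have h4 : MeasurePreserving (fun z : Fin (k + 1) → ℝ => ∑ i, z i ^ 2)
      (Measure.pi fun i : Fin (k + 1) => gaussianReal (if (i : ℕ) = 0 then √l else 0) 1)
      (noncentralChiSq (k + 1) l) := ⟨measurable_sum_sq _, rfl⟩
  have h5 := h4.comp h3
  simp only [Fin.val_zero, if_true, Fin.zero_succAbove, Fin.val_succ, Nat.add_eq_zero_iff,
    one_ne_zero, and_false, if_false] at h5
  have h6 : MeasurePreserving (fun w : ℝ × ℝ => w.1 ^ 2 + w.2)
      ((gaussianReal (√l) 1).prod (chiSq k)) (noncentralChiSq (k + 1) l) := by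
    refine ⟨by fun_prop, ?_⟩
    rw [← ((MeasurePreserving.id (gaussianReal (√l) 1)).prod h2).map_eq,
      Measure.map_map (by fun_prop)
        (measurable_id.prodMap (measurable_sum_sq _)), ← h5.map_eq]
    congr 1
    funext z
    simp [MeasurableEquiv.piFinSuccAbove_symm_apply, Fin.sum_univ_succ]
  exact h6.comp (h1.prod (MeasurePreserving.id _))

/-- A representation of the noncentral F distribution where the excentre parameter only shifts
one standard normal variable. -/
lemma noncentralF_succ (k m : ℕ) (l : ℝ) :
    noncentralF (k + 1) m l =
      (((chiSq k).prod (chiSq m)).prod (gaussianReal 0 1)).map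
        fun w => ((w.2 + √l) ^ 2 + w.1.1) / ((k + 1 : ℕ) : ℝ) / (w.1.2 / m) := by
  have h1 := (measurePreserving_add_sq_add k l).prod (MeasurePreserving.id (chiSq m))
  have h2 := (measurePreserving_prodAssoc (gaussianReal 0 1) (chiSq k) (chiSq m)).symm
  have h3 := Measure.measurePreserving_swap
    (μ := (chiSq k).prod (chiSq m)) (ν := gaussianReal 0 1)
  have h4 := h1.comp (h2.comp h3)
  rw [noncentralF, ← h4.map_eq, Measure.map_map (by fun_prop) h4.measurable]
  rfl

lemma gaussianReal_null_of_finite {s : Set ℝ} (hs : s.Finite) : gaussianReal 0 1 s = 0 := by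
  have := nullSingletonClass_gaussianReal (μ := 0) (one_ne_zero (α := NNReal))
  exact hs.measure_zero _

lemma finite_add_sq_eq (a t : ℝ) : {z : ℝ | (z + a) ^ 2 = t}.Finite := by
  refine (Set.toFinite {√t - a, -√t - a}).subset fun z hz => ?_
  have hz : (z + a) ^ 2 = t := hz
  have ht : √t ^ 2 = t := Real.sq_sqrt (hz ▸ sq_nonneg _)
  rcases sq_eq_sq_iff_eq_or_eq_neg.1 (hz.trans ht.symm) with h | h
  · left; linarith
  · right; simp; linarith

lemma chiSq_ae_nonneg (m : ℕ) : ∀ᵐ w ∂chiSq m, 0 ≤ w := by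
  rw [chiSq, ae_map_iff (measurable_sum_sq _).aemeasurable measurableSet_Ici]
  exact ae_of_all _ fun z => Finset.sum_nonneg fun i _ => sq_nonneg _

lemma chiSq_ae_pos {m : ℕ} (hm : m ≠ 0) : ∀ᵐ w ∂chiSq m, 0 < w := by
  obtain ⟨k, rfl⟩ := Nat.exists_eq_succ_of_ne_zero hm
  rw [← noncentralChiSq_zero, ← (measurePreserving_add_sq_add k 0).map_eq,
    ae_map_iff (by fun_prop) measurableSet_Ioi]
  have h1 : ∀ᵐ z ∂gaussianReal 0 1, z ≠ 0 := by
    rw [ae_iff]; simpa using gaussianReal_null_of_finite (Set.finite_singleton 0)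
  have h2 : ∀ᵐ w ∂(gaussianReal 0 1).prod (chiSq k), w.1 ≠ 0 :=
    Measure.quasiMeasurePreserving_fst.ae h1
  have h3 : ∀ᵐ w ∂(gaussianReal 0 1).prod (chiSq k), 0 ≤ w.2 :=
    Measure.quasiMeasurePreserving_snd.ae (chiSq_ae_nonneg k)
  filter_upwards [h2, h3] with w hw1 hw2
  have : 0 < w.1 ^ 2 := by positivity
  simp only [Real.sqrt_zero, add_zero]
  linarith

lemma ae_snd_pos (k : ℕ) {m : ℕ} (hm : m ≠ 0) :
    ∀ᵐ u ∂(chiSq k).prod (chiSq m), 0 < u.2 :=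
  Measure.quasiMeasurePreserving_snd.ae (chiSq_ae_pos hm)

lemma fRatio_measurable (k m : ℕ) (l : ℝ) :
    Measurable fun w : (ℝ × ℝ) × ℝ =>
      ((w.2 + √l) ^ 2 + w.1.1) / ((k + 1 : ℕ) : ℝ) / (w.1.2 / m) := by
  fun_prop

lemma fRatio_eq_iff {k m : ℕ} (hm : m ≠ 0) {z v w x a : ℝ} (hw : 0 < w) :
    ((z + a) ^ 2 + v) / ((k + 1 : ℕ) : ℝ) / (w / m) = x ↔
      (z + a) ^ 2 = x * (w / m) * ((k + 1 : ℕ) : ℝ) - v := by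
  have hm' : (0 : ℝ) < m := by positivity
  rw [div_eq_iff (by positivity), div_eq_iff (by positivity), eq_sub_iff_add_eq]

lemma fRatio_le_iff {k m : ℕ} (hm : m ≠ 0) {z v w x a : ℝ} (hw : 0 < w) :
    ((z + a) ^ 2 + v) / ((k + 1 : ℕ) : ℝ) / (w / m) ≤ x ↔
      (z + a) ^ 2 ≤ x * (w / m) * ((k + 1 : ℕ) : ℝ) - v := by
  have hm' : (0 : ℝ) < m := by positivity
  rw [div_le_iff₀ (by positivity), div_le_iff₀ (by positivity), le_sub_iff_add_le]

/-- Given the two chi-squared variables, with positive denominator, the ratio equals `x` for at most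
two values of the normal variable. -/
lemma noncentralF_singleton {k m : ℕ} (hk : k ≠ 0) (hm : m ≠ 0) (l x : ℝ) :
    noncentralF k m l {x} = 0 := by
  obtain ⟨k, rfl⟩ := Nat.exists_eq_succ_of_ne_zero hk
  rw [Nat.succ_eq_add_one, noncentralF_succ,
    Measure.map_apply (fRatio_measurable k m l) (measurableSet_singleton x),
    Measure.measure_prod_null (fRatio_measurable k m l (measurableSet_singleton x))]
  filter_upwards [ae_snd_pos k hm] with u hu
  refine gaussianReal_null_of_finite ((finite_add_sq_eq (√l)
    (x * (u.2 / m) * ((k + 1 : ℕ) : ℝ) - u.1)).subset fun z hz => ?_)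
  exact (fRatio_eq_iff hm hu).1 hz

lemma noncentralF_Ioi_pos {k m : ℕ} (hk : k ≠ 0) (hm : m ≠ 0) (l x : ℝ) :
    0 < noncentralF k m l (Ioi x) := by
  obtain ⟨k, rfl⟩ := Nat.exists_eq_succ_of_ne_zero hk
  rw [pos_iff_ne_zero, Nat.succ_eq_add_one, noncentralF_succ,
    Measure.map_apply (fRatio_measurable k m l) measurableSet_Ioi, Ne,
    Measure.measure_prod_null (fRatio_measurable k m l measurableSet_Ioi)]
  intro h
  -- If the tail were null, almost every slice would be null; one such slice with positive
  -- denominator already gives a contradiction, being open and nonempty.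
  obtain ⟨u, hu, hu0⟩ := ((ae_snd_pos k hm).and h).exists
  have hset : Prod.mk u ⁻¹' ((fun w : (ℝ × ℝ) × ℝ =>
      ((w.2 + √l) ^ 2 + w.1.1) / ((k + 1 : ℕ) : ℝ) / (w.1.2 / m)) ⁻¹' Ioi x) =
      {z | x * (u.2 / m) * ((k + 1 : ℕ) : ℝ) - u.1 < (z + √l) ^ 2} := by
    ext z
    have := fRatio_le_iff (k := k) hm (z := z) (v := u.1) (x := x) (a := √l) hu
    simp only [mem_preimage, mem_Ioi, mem_ofPred_eq]
    rw [← not_le, this, not_le]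
  beta_reduce at hu0
  rw [hset, Pi.zero_apply] at hu0
  set t := x * (u.2 / m) * ((k + 1 : ℕ) : ℝ) - u.1
  have hopen : IsOpen {z : ℝ | t < (z + √l) ^ 2} := isOpen_lt (by fun_prop) (by fun_prop)
  have hvol := gaussianReal_absolutelyContinuous' 0 (one_ne_zero (α := NNReal)) hu0
  have hne : ({z : ℝ | t < (z + √l) ^ 2}).Nonempty := by
    -- At this point the shifted square is (|t| + 1)², which exceeds t.
    refine ⟨|t| + 1 - √l, ?_⟩
    have h1 := le_abs_self t
    have h2 := abs_nonneg t
    simp only [mem_ofPred_eq, sub_add_cancel]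
    nlinarith
  exact (hopen.measure_pos volume hne).ne' hvol

/-! ### Dependence of the F distribution function on the excentre parameter -/

instance : NullSingletonClass (gaussianReal 0 1) :=
  nullSingletonClass_gaussianReal one_ne_zero

instance : (gaussianReal 0 1).IsOpenPosMeasure :=
  (gaussianReal_absolutelyContinuous' 0 (one_ne_zero (α := NNReal))).isOpenPosMeasure

/-- The probability that `(Z + a)² ≤ t` for a standard normal variable `Z`. -/
noncomputable def shiftedSqProb (t a : ℝ) : ℝ := (gaussianReal 0 1).real {z | (z + a) ^ 2 ≤ t}

lemma setOf_add_sq_le {t : ℝ} (ht : 0 ≤ t) (a : ℝ) :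
    {z : ℝ | (z + a) ^ 2 ≤ t} = Icc (-√t - a) (√t - a) := by
  ext z
  rw [mem_ofPred_eq, ← Real.sqrt_le_sqrt_iff ht, Real.sqrt_sq_eq_abs, abs_le, mem_Icc]
  constructor <;> rintro ⟨h1, h2⟩ <;> constructor <;> linarith

lemma shiftedSqProb_of_neg {t : ℝ} (ht : t < 0) (a : ℝ) : shiftedSqProb t a = 0 := by
  have : {z : ℝ | (z + a) ^ 2 ≤ t} = ∅ := by
    ext z; simp only [mem_ofPred_eq, mem_empty_iff_false, iff_false, not_le]
    exact ht.trans_le (sq_nonneg _)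
  simp [shiftedSqProb, this]

lemma shiftedSqProb_eq_Ioc {t : ℝ} (ht : 0 ≤ t) (a : ℝ) :
    shiftedSqProb t a = (gaussianReal 0 1).real (Ioc (-√t - a) (√t - a)) := by
  rw [shiftedSqProb, setOf_add_sq_le ht]
  exact measureReal_congr Ioc_ae_eq_Icc.symm

lemma measureReal_Ioc_eq_cdf_sub (μ : Measure ℝ) [IsProbabilityMeasure μ] {c d : ℝ} (h : c ≤ d) :
    μ.real (Ioc c d) = cdf μ d - cdf μ c := by
  rw [cdf_eq_real, cdf_eq_real, ← measureReal_sdiff (Iic_subset_Iic.2 h) measurableSet_Iic]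
  congr 1
  ext x
  simp [and_comm]

lemma shiftedSqProb_eq_cdf {t : ℝ} (ht : 0 ≤ t) (a : ℝ) :
    shiftedSqProb t a = cdf (gaussianReal 0 1) (√t - a) - cdf (gaussianReal 0 1) (-√t - a) := by
  have := Real.sqrt_nonneg t
  rw [shiftedSqProb_eq_Ioc ht, measureReal_Ioc_eq_cdf_sub _ (by linarith)]

lemma continuous_cdf_of_nullSingleton (μ : Measure ℝ) [IsProbabilityMeasure μ]
    (h : ∀ x, μ {x} = 0) : Continuous (cdf μ) := by
  rw [continuous_iff_continuousAt]
  intro x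
  rw [(cdf μ).mono.continuousAt_iff_leftLim_eq_rightLim, (cdf μ).rightLim_eq]
  have h1 := (cdf μ).measure_singleton x
  rw [measure_cdf, h x] at h1
  have h2 := (cdf μ).mono.leftLim_le (le_refl x)
  have h3 := ENNReal.ofReal_eq_zero.1 h1.symm
  linarith

lemma continuous_shiftedSqProb (t : ℝ) : Continuous (shiftedSqProb t) := by
  have hc := continuous_cdf_of_nullSingleton (gaussianReal 0 1) fun x => measure_singleton x
  rcases lt_or_ge t 0 with ht | ht
  · rw [show shiftedSqProb t = fun _ => 0 from funext (shiftedSqProb_of_neg ht)]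
    fun_prop
  · rw [show shiftedSqProb t = _ from funext (shiftedSqProb_eq_cdf ht)]
    fun_prop

lemma measurable_shiftedSqProb (a : ℝ) : Measurable fun t => shiftedSqProb t a := by
  have h : (fun t => shiftedSqProb t a) = fun t => if t < 0 then 0 else
      cdf (gaussianReal 0 1) (√t - a) - cdf (gaussianReal 0 1) (-√t - a) := by
    funext t
    split_ifs with ht
    · exact shiftedSqProb_of_neg ht a
    · exact shiftedSqProb_eq_cdf (not_lt.1 ht) a
  rw [h]
  have hm : Measurable (cdf (gaussianReal 0 1)) := (cdf _).mono.measurable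
  exact Measurable.ite measurableSet_Iio measurable_const (by fun_prop)

lemma shiftedSqProb_nonneg (t a : ℝ) : 0 ≤ shiftedSqProb t a := measureReal_nonneg

lemma shiftedSqProb_le_one (t a : ℝ) : shiftedSqProb t a ≤ 1 := measureReal_le_one

lemma tendsto_shiftedSqProb (t : ℝ) : Tendsto (shiftedSqProb t) atTop (𝓝 0) := by
  rcases lt_or_ge t 0 with ht | ht
  · rw [show shiftedSqProb t = fun _ => 0 from funext (shiftedSqProb_of_neg ht)]
    exact tendsto_const_nhds
  · refine squeeze_zero (shiftedSqProb_nonneg t) (g := fun a => cdf (gaussianReal 0 1) (√t - a))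
      (fun a => ?_) ?_
    · rw [shiftedSqProb_eq_cdf ht]
      linarith [cdf_nonneg (gaussianReal 0 1) (-√t - a)]
    · exact (tendsto_cdf_atBot _).comp (tendsto_const_nhds.add_atBot tendsto_neg_atTop_atBot)

lemma gaussianReal_Ioc {c d : ℝ} (h : c ≤ d) :
    (gaussianReal 0 1).real (Ioc c d) = ∫ x in c..d, gaussianPDFReal 0 1 x := by
  rw [intervalIntegral.integral_of_le h, measureReal_def,
    gaussianReal_apply_eq_integral 0 one_ne_zero, ENNReal.toReal_ofReal]
  exact setIntegral_nonneg measurableSet_Ioc fun x _ => gaussianPDFReal_nonneg 0 1 x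

/-- After the substitutions x ↦ -s - x and x ↦ s - x both integrals run over [a, b], and the
densities compare pointwise: |s - x| ≤ s + x for s, x ≥ 0. -/
lemma gaussianReal_Ioc_shift_le {s a b : ℝ} (hs : 0 ≤ s) (ha : 0 ≤ a) (hab : a ≤ b) :
    (gaussianReal 0 1).real (Ioc (-s - b) (-s - a)) ≤
      (gaussianReal 0 1).real (Ioc (s - b) (s - a)) := by
  rw [gaussianReal_Ioc (by linarith), gaussianReal_Ioc (by linarith),
    ← intervalIntegral.integral_comp_sub_left, ← intervalIntegral.integral_comp_sub_left]
  have hi : ∀ c, IntervalIntegrable (fun x => gaussianPDFReal 0 1 (c - x)) volume a b := fun c =>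
    ((integrable_gaussianPDFReal 0 1).comp_sub_left c).intervalIntegrable
  refine intervalIntegral.integral_mono_on hab (hi _) (hi _) fun x hx => ?_
  simp only [gaussianPDFReal]
  have hx0 : 0 ≤ x := ha.trans hx.1
  refine mul_le_mul_of_nonneg_left (Real.exp_le_exp.2 ?_) (by positivity)
  refine div_le_div_of_nonneg_right ?_ (by positivity)
  nlinarith [mul_nonneg hs hx0]

/-- Moving the interval of radius √t from centre -a to centre -b gains a piece on the left and loses
one on the right; the lost piece is nearer the origin and so has at least the mass of the gained
one. -/
lemma shiftedSqProb_anti (t : ℝ) {a b : ℝ} (ha : 0 ≤ a) (hab : a ≤ b) :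
    shiftedSqProb t b ≤ shiftedSqProb t a := by
  rcases lt_or_ge t 0 with ht | ht
  · simp [shiftedSqProb_of_neg ht]
  · have h := gaussianReal_Ioc_shift_le (Real.sqrt_nonneg t) ha hab
    rw [measureReal_Ioc_eq_cdf_sub _ (by linarith),
      measureReal_Ioc_eq_cdf_sub _ (by linarith)] at h
    rw [shiftedSqProb_eq_cdf ht, shiftedSqProb_eq_cdf ht]
    linarith

/-- Fubini, conditioning on the two chi-squared variables: `l` now enters only through the shift √l
in a bounded integrand. -/
lemma cdf_noncentralF_succ (k : ℕ) {m : ℕ} (hm : m ≠ 0) (l x : ℝ) :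
    cdf (noncentralF (k + 1) m l) x =
      ∫ u, shiftedSqProb (x * (u.2 / m) * ((k + 1 : ℕ) : ℝ) - u.1) (√l)
        ∂(chiSq k).prod (chiSq m) := by
  rw [cdf_eq_real, noncentralF_succ, map_measureReal_apply (fRatio_measurable k m l)
    measurableSet_Iic, measureReal_def,
    Measure.prod_apply (fRatio_measurable k m l measurableSet_Iic),
    ← integral_toReal]
  · refine integral_congr_ae ?_
    filter_upwards [ae_snd_pos k hm] with u hu
    rw [shiftedSqProb, measureReal_def]
    congr 2
    ext z
    exact fRatio_le_iff hm hu
  · exact (measurable_measure_prodMk_left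
      (fRatio_measurable k m l measurableSet_Iic)).aemeasurable
  · exact ae_of_all _ fun u => measure_lt_top _ _

lemma aestronglyMeasurable_shiftedSqProb (k m : ℕ) (x a : ℝ) :
    AEStronglyMeasurable (fun u : ℝ × ℝ =>
      shiftedSqProb (x * (u.2 / m) * ((k + 1 : ℕ) : ℝ) - u.1) a)
      ((chiSq k).prod (chiSq m)) := by
  refine Measurable.aestronglyMeasurable ?_
  exact (measurable_shiftedSqProb a).comp (by fun_prop)

lemma norm_shiftedSqProb_le (t a : ℝ) : ‖shiftedSqProb t a‖ ≤ 1 := by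
  rw [Real.norm_of_nonneg (shiftedSqProb_nonneg t a)]
  exact shiftedSqProb_le_one t a

section

variable {k m : ℕ} (hk : k ≠ 0) (hm : m ≠ 0) (x : ℝ)
include hk hm

/-- No sign condition on `l` is needed: `Real.sqrt` vanishes on negative numbers, so the function is
constant there. This lets `exists_cdf_eq_ite` be applied with a globally antitone function. -/
lemma antitone_cdf_noncentralF : Antitone fun l => cdf (noncentralF k m l) x := by
  obtain ⟨k, rfl⟩ := Nat.exists_eq_succ_of_ne_zero hk
  intro l l' hl
  simp only [Nat.succ_eq_add_one, cdf_noncentralF_succ k hm]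
  have hi : ∀ a, Integrable (fun u : ℝ × ℝ =>
      shiftedSqProb (x * (u.2 / m) * ((k + 1 : ℕ) : ℝ) - u.1) a)
      ((chiSq k).prod (chiSq m)) := fun a =>
    Integrable.of_bound (aestronglyMeasurable_shiftedSqProb k m x a) 1
      (ae_of_all _ fun u => norm_shiftedSqProb_le _ _)
  exact integral_mono (hi _) (hi _) fun u =>
    shiftedSqProb_anti _ (Real.sqrt_nonneg _) (Real.sqrt_le_sqrt hl)

lemma continuous_cdf_noncentralF : Continuous fun l => cdf (noncentralF k m l) x := by
  obtain ⟨k, rfl⟩ := Nat.exists_eq_succ_of_ne_zero hk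
  simp only [Nat.succ_eq_add_one, cdf_noncentralF_succ k hm]
  exact continuous_of_dominated (bound := fun _ => 1)
    (fun l => aestronglyMeasurable_shiftedSqProb k m x _)
    (fun l => ae_of_all _ fun u => norm_shiftedSqProb_le _ _) (integrable_const _)
    (ae_of_all _ fun u => (continuous_shiftedSqProb _).comp Real.continuous_sqrt)

lemma tendsto_cdf_noncentralF :
    Tendsto (fun l => cdf (noncentralF k m l) x) atTop (𝓝 0) := by
  obtain ⟨k, rfl⟩ := Nat.exists_eq_succ_of_ne_zero hk
  simp only [Nat.succ_eq_add_one, cdf_noncentralF_succ k hm]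
  rw [show (0 : ℝ) = ∫ _, (0 : ℝ) ∂(chiSq k).prod (chiSq m) by simp]
  exact tendsto_integral_filter_of_dominated_convergence (fun _ => 1)
    (Eventually.of_forall fun l => aestronglyMeasurable_shiftedSqProb k m x _)
    (Eventually.of_forall fun l => ae_of_all _ fun u => norm_shiftedSqProb_le _ _)
    (integrable_const _)
    (ae_of_all _ fun u => (tendsto_shiftedSqProb _).comp Real.tendsto_sqrt_atTop)

lemma cdf_noncentralF_lt_one (l : ℝ) : cdf (noncentralF k m l) x < 1 := by
  have h := noncentralF_Ioi_pos hk hm l x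
  have h1 : (noncentralF k m l).real (Ioi x) = 1 - (noncentralF k m l).real (Iic x) := by
    rw [← compl_Iic, probReal_compl_eq_one_sub measurableSet_Iic]
  have h2 : 0 < (noncentralF k m l).real (Ioi x) :=
    ENNReal.toReal_pos h.ne' (measure_ne_top _ _)
  rw [cdf_eq_real]
  linarith

end

/-! ### Distribution functions on the line -/

/-- The probability integral transform, in terms of upper tails. -/
lemma measure_le_cdf (μ : Measure ℝ) [IsProbabilityMeasure μ] (h : ∀ x, μ {x} = 0)
    {u : ℝ} (hu : u ∈ Ioo (0 : ℝ) 1) : μ {x | u ≤ cdf μ x} = ENNReal.ofReal (1 - u) := by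
  have hc := continuous_cdf_of_nullSingleton μ h
  obtain ⟨x₀, hx₀⟩ : u ∈ range (cdf μ) := mem_range_of_exists_le_of_exists_ge hc
    (((tendsto_cdf_atBot μ).eventually_le_const hu.1).exists)
    (((tendsto_cdf_atTop μ).eventually_const_le hu.2).exists)
  have hclosed : IsClosed {x | u ≤ cdf μ x} := isClosed_le continuous_const hc
  have hne : {x | u ≤ cdf μ x}.Nonempty := ⟨x₀, hx₀.ge⟩
  obtain ⟨y, hy⟩ := ((tendsto_cdf_atBot μ).eventually_lt_const hu.1).exists
  have hbdd : BddBelow {x | u ≤ cdf μ x} := ⟨y, fun x hx => by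
    by_contra! hxy
    exact absurd ((cdf μ).mono hxy.le) (not_le.2 (hy.trans_le hx))⟩
  -- The distribution function may have flat stretches, so there need not be a unique u-quantile;
  -- the smallest one turns the superlevel set into a closed half-line.
  set x₁ := sInf {x | u ≤ cdf μ x}
  have h1 : u ≤ cdf μ x₁ := hclosed.csInf_mem hne hbdd
  have h2 : cdf μ x₁ ≤ u := hx₀ ▸ (cdf μ).mono (csInf_le hbdd hx₀.ge)
  have hset : {x | u ≤ cdf μ x} = Ici x₁ := by
    ext x
    exact ⟨fun hx => csInf_le hbdd hx, fun hx => h1.trans ((cdf μ).mono hx)⟩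
  have : NullSingletonClass μ := ⟨h⟩
  rw [hset, ← measure_congr Ioi_ae_eq_Ici, ← compl_Iic, prob_compl_eq_one_sub measurableSet_Iic,
    ← ofReal_cdf, le_antisymm h2 h1, ENNReal.ofReal_sub _ hu.1.le, ENNReal.ofReal_one]

/-- A distribution function with a jump at `a`, glued from zero and a decreasing function `g`. -/
lemma exists_cdf_eq_ite {g : ℝ → ℝ} (hg : Antitone g) (hgc : Continuous g)
    (hlim : Tendsto g atTop (𝓝 0)) (hg1 : ∀ x, g x ≤ 1) (a : ℝ) :
    ∃ μ : Measure ℝ, IsProbabilityMeasure μ ∧ ∀ r, cdf μ r = if a ≤ r then 1 - g r else 0 := by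
  classical
  let f : StieltjesFunction ℝ :=
    { toFun := fun r => if a ≤ r then 1 - g r else 0
      mono' := by
        intro r r' hr
        dsimp only
        split_ifs with h1 h2 h2
        · linarith [hg hr]
        · exact absurd (h1.trans hr) h2
        · linarith [hg1 r']
        · exact le_rfl
      right_continuous' := by
        intro r
        rcases le_or_gt a r with h | h
        · refine (continuousWithinAt_const.sub hgc.continuousWithinAt).congr
            (fun y hy => if_pos (h.trans hy)) (if_pos h)
        · refine (continuousAt_const (y := (0 : ℝ))).congr ?_ |>.continuousWithinAt
          filter_upwards [gt_mem_nhds h] with y hy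
          exact (if_neg (not_le.2 hy)).symm }
  have hf0 : Tendsto f atBot (𝓝 0) := by
    refine tendsto_const_nhds.congr' ?_
    filter_upwards [eventually_lt_atBot a] with y hy
    exact (if_neg (not_le.2 hy)).symm
  have hf1 : Tendsto f atTop (𝓝 1) := by
    have h1 : Tendsto (fun r => 1 - g r) atTop (𝓝 1) := by
      simpa using hlim.const_sub 1
    refine h1.congr' ?_
    filter_upwards [eventually_ge_atTop a] with y hy
    exact (if_pos hy).symm
  exact ⟨f.measure, f.isProbabilityMeasure hf0 hf1, fun r => by
    rw [cdf_measure_stieltjesFunction f hf0 hf1]⟩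

lemma measureReal_singleton_of_cdf {μ : Measure ℝ} [IsProbabilityMeasure μ] {a : ℝ}
    (h : ∀ r < a, cdf μ r = 0) : μ.real {a} = cdf μ a := by
  have h1 := (cdf μ).measure_singleton a
  have h2 : Function.leftLim (cdf μ) a = 0 := by
    refine leftLim_eq_of_tendsto ?_
    refine tendsto_const_nhds.congr' ?_
    filter_upwards [self_mem_nhdsWithin] with r hr
    exact (h r hr).symm
  rw [measure_cdf, h2, sub_zero] at h1
  rw [measureReal_def, h1, ENNReal.toReal_ofReal (cdf_nonneg μ a)]

/-! ### Rotations of normal vectors and factorisation of projections -/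

/-- The law of a vector of independent standard normal variables. -/
noncomputable abbrev stdNormal (ι : Type*) [Fintype ι] : Measure (ι → ℝ) :=
  Measure.pi fun _ => gaussianReal 0 1

section

variable {ι κ : Type*} [Fintype ι] [Fintype κ]

lemma dotProduct_mulVec_self_of_mul_transpose (U : Matrix κ ι ℝ) (z : ι → ℝ) :
    (U *ᵥ z) ⬝ᵥ (U *ᵥ z) = z ⬝ᵥ ((Uᵀ * U) *ᵥ z) := by
  rw [← mulVec_mulVec, dotProduct_mulVec z, vecMul_transpose]

/-- A matrix with orthonormal rows maps a standard normal vector to a standard normal vector. -/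
lemma measurePreserving_mulVec [DecidableEq κ] {U : Matrix κ ι ℝ} (hU : U * Uᵀ = 1) :
    MeasurePreserving (fun z => U *ᵥ z) (stdNormal ι) (stdNormal κ) := by
  have hm : Measurable fun z : ι → ℝ => U *ᵥ z :=
    (Continuous.matrix_mulVec continuous_const continuous_id).measurable
  refine ⟨hm, ?_⟩
  classical
  -- In Euclidean space the characteristic function of a standard normal vector depends only on the
  -- norm of its argument, and `Uᵀ` preserves norms because `U * Uᵀ = 1`.
  have key : ((stdNormal ι).map fun z => U *ᵥ z).map (WithLp.toLp 2) =
      (stdNormal κ).map (WithLp.toLp 2) := by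
    apply Measure.ext_of_charFun (E := EuclideanSpace ℝ κ)
    ext t
    have h1 : charFun (((stdNormal ι).map fun z => U *ᵥ z).map (WithLp.toLp 2)) t =
        charFun ((stdNormal ι).map (WithLp.toLp 2)) (WithLp.toLp 2 (Uᵀ *ᵥ t.ofLp)) := by
      rw [Measure.map_map (by fun_prop) hm, charFun_apply, charFun_apply,
        integral_map (by fun_prop) (by fun_prop), integral_map (by fun_prop) (by fun_prop)]
      congr 1
      funext z
      congr 3
      simp only [Function.comp_apply, EuclideanSpace.inner_eq_star_dotProduct, star_trivial]
      rw [mulVec_transpose, ← dotProduct_mulVec]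
    rw [h1, map_pi_eq_stdGaussian, map_pi_eq_stdGaussian, charFun_stdGaussian,
      charFun_stdGaussian]
    have h2 : ‖(WithLp.toLp 2 (Uᵀ *ᵥ t.ofLp) : EuclideanSpace ℝ ι)‖ ^ 2 = ‖t‖ ^ 2 := by
      rw [← real_inner_self_eq_norm_sq, ← real_inner_self_eq_norm_sq]
      simp only [EuclideanSpace.inner_eq_star_dotProduct, star_trivial]
      rw [dotProduct_mulVec_self_of_mul_transpose, transpose_transpose, hU, one_mulVec]
    norm_cast
    rw [h2]
  have h3 := congrArg (Measure.map (WithLp.ofLp (p := 2) (V := κ → ℝ))) key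
  have h4 : ∀ μ : Measure (κ → ℝ), (μ.map (WithLp.toLp 2)).map WithLp.ofLp = μ := fun μ => by
    rw [Measure.map_map (by fun_prop) (by fun_prop)]
    exact Measure.map_id
  rwa [h4, h4] at h3

end

/-- The rows of `O` form an orthonormal basis whose first vector points along `a`; when `a` is zero
any unit vector serves. -/
lemma exists_orthogonal_mulVec_eq {k : ℕ} (hk : k ≠ 0) (a : Fin k → ℝ) :
    ∃ O : Matrix (Fin k) (Fin k) ℝ, O * Oᵀ = 1 ∧
      O *ᵥ a = fun i : Fin k => if (i : ℕ) = 0 then √(a ⬝ᵥ a) else 0 := by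
  let i₀ : Fin k := ⟨0, Nat.pos_of_ne_zero hk⟩
  let v : EuclideanSpace ℝ (Fin k) := WithLp.toLp 2 a
  have hva : ‖v‖ = √(a ⬝ᵥ a) := by
    rw [norm_eq_sqrt_real_inner, EuclideanSpace.inner_eq_star_dotProduct, star_trivial]
  obtain ⟨e, he, hev⟩ : ∃ e : EuclideanSpace ℝ (Fin k), ‖e‖ = 1 ∧ v = ‖v‖ • e := by
    by_cases hv : v = 0
    · exact ⟨EuclideanSpace.single i₀ 1, by simp, by simp [hv]⟩
    · have : ‖v‖ ≠ 0 := norm_ne_zero_iff.2 hv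
      exact ⟨‖v‖⁻¹ • v, by rw [norm_smul, norm_inv, norm_norm, inv_mul_cancel₀ this],
        by rw [smul_smul, mul_inv_cancel₀ this, one_smul]⟩
  obtain ⟨b, hb⟩ := Orthonormal.exists_orthonormalBasis_extension_of_card_eq (𝕜 := ℝ)
    (E := EuclideanSpace ℝ (Fin k)) (ι := Fin k) (by simp) (v := fun _ => e) (s := {i₀}) (by
      refine ⟨fun _ => he, fun i j hij => absurd (Subsingleton.elim i j) hij⟩)
  have hb0 : b i₀ = e := hb i₀ rfl
  refine ⟨Matrix.of fun i j => b i j, ?_, ?_⟩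
  · ext i j
    have := b.inner_eq_ite j i
    rw [EuclideanSpace.inner_eq_star_dotProduct, star_trivial] at this
    rw [mul_apply, one_apply]
    simp only [eq_comm (a := i)]
    rw [← this]
    rfl
  · funext i
    have h1 : (Matrix.of fun i j => b i j) *ᵥ a = fun i => inner ℝ v (b i) := by
      funext i
      rw [EuclideanSpace.inner_eq_star_dotProduct, star_trivial]
      rfl
    rw [h1]
    dsimp only
    rw [hev, real_inner_smul_left, ← hb0, b.inner_eq_ite, hva]
    have : (i₀ = i) ↔ (i : ℕ) = 0 := by rw [eq_comm, Fin.ext_iff]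
    simp [this]

/-- The sum of squares of independent unit-variance normal variables has a noncentral chi-squared
distribution, depending on the means only through the sum of their squares. -/
lemma measurePreserving_sum_sq_add {k : ℕ} (hk : k ≠ 0) (a : Fin k → ℝ) :
    MeasurePreserving (fun z : Fin k → ℝ => (z + a) ⬝ᵥ (z + a)) (stdNormal (Fin k))
      (noncentralChiSq k (a ⬝ᵥ a)) := by
  obtain ⟨O, hO, hOa⟩ := exists_orthogonal_mulVec_eq hk a
  have h1 : MeasurePreserving
      (fun (z : Fin k → ℝ) i => z i + if (i : ℕ) = 0 then √(a ⬝ᵥ a) else 0)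
      (stdNormal (Fin k))
      (Measure.pi fun i : Fin k => gaussianReal (if (i : ℕ) = 0 then √(a ⬝ᵥ a) else 0) 1) := by
    refine measurePreserving_pi (fun _ => gaussianReal 0 1)
      (fun i : Fin k => gaussianReal (if (i : ℕ) = 0 then √(a ⬝ᵥ a) else 0) 1)
      (f := fun i z => z + if (i : ℕ) = 0 then √(a ⬝ᵥ a) else 0) fun i => ⟨by fun_prop, ?_⟩
    rw [gaussianReal_map_add_const, zero_add]
  have h2 : MeasurePreserving (fun z : Fin k → ℝ => ∑ i, z i ^ 2)
      (Measure.pi fun i : Fin k => gaussianReal (if (i : ℕ) = 0 then √(a ⬝ᵥ a) else 0) 1)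
      (noncentralChiSq k (a ⬝ᵥ a)) := ⟨measurable_sum_sq _, rfl⟩
  have h3 := h2.comp (h1.comp (measurePreserving_mulVec hO))
  convert h3 using 1
  funext z
  have hO' : Oᵀ * O = 1 := mul_eq_one_comm.1 hO
  have h4 := dotProduct_mulVec_self_of_mul_transpose O (z + a)
  rw [hO', one_mulVec, mulVec_add, hOa] at h4
  rw [← h4]
  simp [dotProduct, sq]

/-- An orthogonal projection of rank `r` factors through a matrix with `r` orthonormal rows. -/
lemma exists_transpose_mul_eq_of_isProj {n r : ℕ} {A : Matrix (Fin n) (Fin n) ℝ} (hA : Aᵀ = A)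
    (hAA : A * A = A) (hr : A.trace = r) :
    ∃ U : Matrix (Fin r) (Fin n) ℝ, U * Uᵀ = 1 ∧ Uᵀ * U = A := by
  let W : Submodule ℝ (EuclideanSpace ℝ (Fin n)) := LinearMap.range (toEuclideanLin A)
  let b := stdOrthonormalBasis ℝ W
  let U : Matrix (Fin (Module.finrank ℝ W)) (Fin n) ℝ :=
    Matrix.of fun i j => (b i : EuclideanSpace ℝ (Fin n)) j
  have h1 : U * Uᵀ = 1 := by
    ext i j
    have := b.inner_eq_ite j i
    rw [Submodule.coe_inner, EuclideanSpace.inner_eq_star_dotProduct, star_trivial] at this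
    rw [mul_apply, one_apply]
    simp only [eq_comm (a := i)]
    rw [← this]
    rfl
  -- The rows of `U` lie in the range of `A`, on which the idempotent `A` acts as the identity.
  have h2 : U * A = U := by
    ext i j
    obtain ⟨c, hc⟩ : ∃ c, toEuclideanLin A c = (b i : EuclideanSpace ℝ (Fin n)) := (b i).2
    have hc' : U i = A *ᵥ c.ofLp := by
      rw [show U i = (b i : EuclideanSpace ℝ (Fin n)).ofLp from rfl, ← hc]
      rfl
    rw [mul_apply_eq_vecMul, hc', ← mulVec_transpose, hA, mulVec_mulVec, hAA]
  -- This is the expansion of the vectors `A y` in the orthonormal basis of the range.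
  have h3 : Uᵀ * (U * A) = A := by
    refine ext_of_mulVec_single fun j => ?_
    set y : Fin n → ℝ := Pi.single j 1
    let w : W := ⟨toEuclideanLin A (WithLp.toLp 2 y), LinearMap.mem_range_self _ _⟩
    have hw := congrArg (fun u : W => (u : EuclideanSpace ℝ (Fin n)).ofLp) (b.sum_repr' w)
    have hw' : (w : EuclideanSpace ℝ (Fin n)).ofLp = A *ᵥ y := rfl
    rw [← mulVec_mulVec, ← mulVec_mulVec]
    dsimp only at hw
    rw [hw'] at hw
    refine Eq.trans ?_ hw
    funext j'
    simp only [Submodule.coe_sum, Submodule.coe_smul, WithLp.ofLp_sum, WithLp.ofLp_smul,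
      Finset.sum_apply, Pi.smul_apply, smul_eq_mul, Submodule.coe_inner,
      EuclideanSpace.inner_eq_star_dotProduct, star_trivial]
    rw [mulVec, dotProduct]
    refine Finset.sum_congr rfl fun i _ => ?_
    rw [mul_comm, transpose_apply, hw', dotProduct_comm]
    rfl
  rw [h2] at h3
  -- The traces of `U * Uᵀ = 1` and `Uᵀ * U = A` agree, so the rank is the trace.
  have h4 : Module.finrank ℝ W = r := by
    have := trace_mul_comm U Uᵀ
    rw [h1, h3, trace_one, Fintype.card_fin, hr] at this
    exact_mod_cast this
  clear_value U
  subst h4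
  exact ⟨U, h1, h3⟩

/-! ### Hat matrices and least squares -/

section hat

variable {n : ℕ} {ι : Type*} [Fintype ι] [DecidableEq ι]

/-- The hat matrix, projecting on the column space of `Z`. -/
noncomputable def hat (Z : Matrix (Fin n) ι ℝ) : Matrix (Fin n) (Fin n) ℝ :=
  Z * (Zᵀ * Z)⁻¹ * Zᵀ

lemma hat_transpose (Z : Matrix (Fin n) ι ℝ) : (hat Z)ᵀ = hat Z := by
  simp [hat, transpose_nonsing_inv, Matrix.mul_assoc]

lemma hat_mul {Z : Matrix (Fin n) ι ℝ} (hZ : IsUnit (Zᵀ * Z).det) : hat Z * Z = Z := by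
  rw [hat, Matrix.mul_assoc, Matrix.mul_assoc, nonsing_inv_mul _ hZ, Matrix.mul_one]

lemma mul_hat_of_mul_eq {Z : Matrix (Fin n) ι ℝ} {H : Matrix (Fin n) (Fin n) ℝ} (h : H * Z = Z) :
    H * hat Z = hat Z := by
  rw [hat, ← Matrix.mul_assoc, ← Matrix.mul_assoc, h]

lemma hat_mul_hat {Z : Matrix (Fin n) ι ℝ} (hZ : IsUnit (Zᵀ * Z).det) : hat Z * hat Z = hat Z :=
  mul_hat_of_mul_eq (hat_mul hZ)

lemma trace_hat {Z : Matrix (Fin n) ι ℝ} (hZ : IsUnit (Zᵀ * Z).det) :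
    (hat Z).trace = Fintype.card ι := by
  rw [hat, trace_mul_comm, ← Matrix.mul_assoc, mul_nonsing_inv _ hZ, trace_one]

lemma nonsing_inv_inv_smul {c : ℝ} (hc : c ≠ 0) {A : Matrix ι ι ℝ} (hA : IsUnit A.det) :
    (c⁻¹ • A)⁻¹ = c • A⁻¹ := by
  refine inv_eq_right_inv ?_
  rw [Matrix.smul_mul, Matrix.mul_smul, smul_smul, inv_mul_cancel₀ hc, one_smul,
    mul_nonsing_inv _ hA]

omit [Fintype ι] [DecidableEq ι] in
lemma sum_vecMulVec_rows (Z : Matrix (Fin n) ι ℝ) : ∑ i, vecMulVec (Z i) (Z i) = Zᵀ * Z := by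
  ext j j'
  simp [Matrix.sum_apply, vecMulVec_apply, mul_apply]

omit [Fintype ι] [DecidableEq ι] in
lemma sum_smul_rows (Z : Matrix (Fin n) ι ℝ) (y : Fin n → ℝ) : ∑ i, y i • Z i = Zᵀ *ᵥ y := by
  ext j
  simp [mulVec, dotProduct, mul_comm]

lemma mulVec_leastSquares {Z : Matrix (Fin n) ι ℝ} (hZ : IsUnit (Zᵀ * Z).det) (hn : (n : ℝ) ≠ 0)
    (y : Fin n → ℝ) :
    Z *ᵥ (((n : ℝ)⁻¹ • ∑ i, vecMulVec (Z i) (Z i))⁻¹ *ᵥ ((n : ℝ)⁻¹ • ∑ i, y i • Z i)) =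
      hat Z *ᵥ y := by
  rw [sum_vecMulVec_rows, sum_smul_rows, nonsing_inv_inv_smul hn hZ, smul_mulVec, mulVec_smul,
    mulVec_smul, mulVec_smul, smul_smul, mul_inv_cancel₀ hn, one_smul,
    mulVec_mulVec, mulVec_mulVec, hat]

end hat

/-! ### Submodels: nested projections and the quadratic form of Q_S⁻¹ -/

section model

variable {n p : ℕ}

/-- The design matrix of the submodel `S`. -/
def subDesign (X : Matrix (Fin n) (Fin p) ℝ) (S : Finset (Fin p)) :
    Matrix (Fin n) {j // j ∈ S} ℝ := X.submatrix id Subtype.val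

variable {X : Matrix (Fin n) (Fin p) ℝ}

lemma posDef_gram_of_rank (hX : (sigmaN X).rank = p) : (Xᵀ * X).PosDef := by
  have h1 : (Xᵀ * X).PosSemidef := by
    simpa [conjTranspose_eq_transpose_of_trivial] using posSemidef_conjTranspose_mul_self X
  rw [h1.posDef_iff_isUnit]
  have h2 : LinearMap.range (sigmaN X).mulVecLin = ⊤ := by
    apply Submodule.eq_top_of_finrank_eq
    rw [Module.finrank_fin_fun]
    exact hX
  have h3 : IsUnit (sigmaN X) := by
    rw [← mulVec_surjective_iff_isUnit]
    exact LinearMap.range_eq_top.1 h2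
  rw [sigmaN, sum_vecMulVec_rows] at h3
  rw [isUnit_iff_isUnit_det, det_smul] at h3
  rw [isUnit_iff_isUnit_det]
  exact isUnit_of_mul_isUnit_right h3

variable (S : Finset (Fin p))

lemma extend_mulVec (X : Matrix (Fin n) (Fin p) ℝ) {u : Fin p → ℝ} (hu : ∀ j ∉ S, u j = 0) :
    X *ᵥ u = subDesign X S *ᵥ sub S u := by
  funext i
  simp only [mulVec, dotProduct, subDesign, submatrix_apply, id, sub]
  rw [← Finset.sum_subset (Finset.subset_univ S) (fun j _ hj => by rw [hu j hj, mul_zero])]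
  exact (Finset.sum_coe_sort S fun j => X i j * u j).symm

section

variable (hG : (Xᵀ * X).PosDef)
include hG

lemma isUnit_det_gram : IsUnit (Xᵀ * X).det := (isUnit_iff_isUnit_det _).1 hG.isUnit

lemma isUnit_det_subGram : IsUnit ((subDesign X S)ᵀ * subDesign X S).det :=
  (isUnit_iff_isUnit_det _).1 (hG.submatrix Subtype.val_injective).isUnit

lemma isUnit_det_invBlock :
    IsUnit ((Xᵀ * X)⁻¹.submatrix (Subtype.val : {j // j ∉ S} → Fin p) Subtype.val).det :=
  (isUnit_iff_isUnit_det _).1 (hG.inv.submatrix Subtype.val_injective).isUnit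

lemma hat_mul_subDesign : hat X * subDesign X S = subDesign X S := by
  have h := hat_mul (isUnit_det_gram hG)
  calc hat X * subDesign X S = (hat X * X).submatrix id Subtype.val := rfl
    _ = subDesign X S := by rw [h]; rfl

lemma hat_mul_hat_sub : hat X * hat (subDesign X S) = hat (subDesign X S) :=
  mul_hat_of_mul_eq (hat_mul_subDesign S hG)

lemma hat_sub_mul_hat : hat (subDesign X S) * hat X = hat (subDesign X S) := by
  have := congrArg transpose (hat_mul_hat_sub S hG)
  rwa [transpose_mul, hat_transpose, hat_transpose] at this

/-- The quadratic form of the inverse block of the inverse Gram matrix is the squared length of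
the fitted vector after projecting out the submodel. -/
lemma subCompl_quadForm_eq (b : Fin p → ℝ) :
    subCompl S b ⬝ᵥ
      (((Xᵀ * X)⁻¹.submatrix (Subtype.val : {j // j ∉ S} → Fin p) Subtype.val)⁻¹ *ᵥ
        subCompl S b) =
      (X *ᵥ b) ⬝ᵥ ((1 - hat (subDesign X S)) *ᵥ (X *ᵥ b)) := by
  set K := (Xᵀ * X)⁻¹.submatrix (Subtype.val : {j // j ∉ S} → Fin p) Subtype.val with hK
  set c := K⁻¹ *ᵥ subCompl S b with hc
  -- Extend `c` by zero on `S` and solve the normal equations for `w`. Then `w` and `b` agree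
  -- outside `S`, so X(b - w) lies in the column space of the submodel; and Xw is orthogonal to that
  -- space because `e` vanishes on `S`. Hence Xw is the residual of Xb in the submodel.
  let e : Fin p → ℝ := fun j => if h : j ∈ S then 0 else c ⟨j, h⟩
  have he : ∀ u : Fin p → ℝ, u ⬝ᵥ e = subCompl S u ⬝ᵥ c := by
    intro u
    simp only [dotProduct, subCompl]
    have h1 : ∑ j, u j * e j = ∑ j ∈ Finset.univ.filter (· ∉ S), u j * e j := by
      rw [Finset.sum_filter_of_ne]
      intro j _ hj hjS
      exact hj (by simp [e, hjS])
    rw [h1, Finset.sum_subtype (p := (· ∉ S)) _ (by simp)]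
    refine Finset.sum_congr rfl fun j _ => ?_
    simp [e, j.2]
  set w := (Xᵀ * X)⁻¹ *ᵥ e with hw
  have hGw : (Xᵀ * X) *ᵥ w = e := by
    rw [hw, mulVec_mulVec, mul_nonsing_inv _ (isUnit_det_gram hG), one_mulVec]
  have hwc : subCompl S w = subCompl S b := by
    have h1 : subCompl S w = K *ᵥ c := by
      funext j
      simp only [subCompl, hw, mulVec]
      rw [he]
      rfl
    rw [h1, hc, mulVec_mulVec, mul_nonsing_inv _ (isUnit_det_invBlock S hG), one_mulVec]
  have h2 : X *ᵥ (b - w) = subDesign X S *ᵥ sub S (b - w) := by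
    refine extend_mulVec S X fun j hj => ?_
    have := congrFun hwc ⟨j, hj⟩
    simp only [subCompl] at this
    rw [Pi.sub_apply, this, sub_self]
  have h3 : (1 - hat (subDesign X S)) *ᵥ (X *ᵥ (b - w)) = 0 := by
    rw [h2, mulVec_mulVec, Matrix.sub_mul, hat_mul (isUnit_det_subGram S hG), Matrix.one_mul,
      sub_self, zero_mulVec]
  have h4 : hat (subDesign X S) *ᵥ (X *ᵥ w) = 0 := by
    have h5 : (subDesign X S)ᵀ *ᵥ (X *ᵥ w) = 0 := by
      funext j
      have h6 : ((subDesign X S)ᵀ *ᵥ (X *ᵥ w)) j = ((Xᵀ * X) *ᵥ w) j := by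
        rw [← mulVec_mulVec]; rfl
      rw [h6, hGw]
      simp [e]
    rw [hat, ← mulVec_mulVec, h5, mulVec_zero]
  have h7 : (1 - hat (subDesign X S)) *ᵥ (X *ᵥ b) = X *ᵥ w := by
    have h8 : X *ᵥ b = X *ᵥ w + X *ᵥ (b - w) := by rw [← mulVec_add, add_sub_cancel]
    rw [h8, mulVec_add, h3, add_zero, sub_mulVec, h4, one_mulVec, sub_zero]
  rw [h7, ← he, ← hGw, ← mulVec_mulVec, dotProduct_mulVec, vecMul_transpose]

lemma mulVec_betaWide (hn : (n : ℝ) ≠ 0) (y : Fin n → ℝ) : X *ᵥ betaWide X y = hat X *ᵥ y :=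
  mulVec_leastSquares (isUnit_det_gram hG) hn y

lemma mulVec_betaSub (hn : (n : ℝ) ≠ 0) (y : Fin n → ℝ) :
    subDesign X S *ᵥ betaSub X S y = hat (subDesign X S) *ᵥ y :=
  mulVec_leastSquares (Z := subDesign X S) (isUnit_det_subGram S hG) hn y

/-- The factor `n` cancels the normalisation of Σ_n, leaving the inverse Gram matrix. -/
lemma mul_quadForm_QS (hn : (n : ℝ) ≠ 0) (b : Fin p → ℝ) :
    n * (subCompl S b ⬝ᵥ ((QS X S)⁻¹ *ᵥ subCompl S b)) =
      (X *ᵥ b) ⬝ᵥ ((1 - hat (subDesign X S)) *ᵥ (X *ᵥ b)) := by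
  have h : (QS X S)⁻¹ = (n : ℝ)⁻¹ •
      ((Xᵀ * X)⁻¹.submatrix (Subtype.val : {j // j ∉ S} → Fin p) Subtype.val)⁻¹ := by
    rw [QS, sigmaN, sum_vecMulVec_rows, nonsing_inv_inv_smul hn (isUnit_det_gram hG),
      submatrix_smul]
    have := nonsing_inv_inv_smul (inv_ne_zero hn) (isUnit_det_invBlock S hG)
    rwa [inv_inv] at this
  rw [h, smul_mulVec, dotProduct_smul, smul_eq_mul, mul_inv_cancel_left₀ hn,
    subCompl_quadForm_eq S hG]

omit hG in
lemma dotProduct_mulVec_mulVec_self {H A : Matrix (Fin n) (Fin n) ℝ} (hH : Hᵀ = H)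
    (y : Fin n → ℝ) : (H *ᵥ y) ⬝ᵥ (A *ᵥ (H *ᵥ y)) = y ⬝ᵥ ((H * A * H) *ᵥ y) := by
  rw [← mulVec_mulVec, ← mulVec_mulVec, dotProduct_mulVec y, ← mulVec_transpose, hH]

/-- The fitted vector is Hy, and H(1 - H_S)H = H - H_S because the column spaces are nested. -/
lemma gammaTilde_num (hn : (n : ℝ) ≠ 0) (y : Fin n → ℝ) :
    n * (subCompl S (betaWide X y) ⬝ᵥ ((QS X S)⁻¹ *ᵥ subCompl S (betaWide X y))) =
      y ⬝ᵥ ((hat X - hat (subDesign X S)) *ᵥ y) := by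
  rw [mul_quadForm_QS S hG hn, mulVec_betaWide hG hn,
    dotProduct_mulVec_mulVec_self (hat_transpose X)]
  congr 2
  rw [Matrix.mul_sub, Matrix.mul_one, Matrix.sub_mul, hat_mul_hat (isUnit_det_gram hG),
    hat_mul_hat_sub S hG, hat_sub_mul_hat S hG]

lemma sigmaHatSq_eq (hn : (n : ℝ) ≠ 0) (y : Fin n → ℝ) :
    sigmaHatSq X y = y ⬝ᵥ ((1 - hat X) *ᵥ y) / ((n : ℝ) - p) := by
  have h : ∑ i, (y i - X i ⬝ᵥ betaWide X y) ^ 2 =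
      ((1 - hat X) *ᵥ y) ⬝ᵥ ((1 - hat X) *ᵥ y) := by
    rw [sub_mulVec, one_mulVec, ← mulVec_betaWide hG hn]
    simp [dotProduct, sq, mulVec]
  rw [sigmaHatSq, h, dotProduct_mulVec_self_of_mul_transpose, transpose_sub, transpose_one,
    hat_transpose, Matrix.sub_mul, Matrix.mul_sub, Matrix.mul_sub,
    hat_mul_hat (isUnit_det_gram hG), div_eq_inv_mul]
  simp

lemma gammaS_eq (hn : (n : ℝ) ≠ 0) (β : Fin p → ℝ) (σ : ℝ) :
    gammaS X S β σ = (X *ᵥ β) ⬝ᵥ ((1 - hat (subDesign X S)) *ᵥ (X *ᵥ β)) / σ ^ 2 := by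
  rw [gammaS, mul_quadForm_QS S hG hn]

end

end model

/-! ### Laws and means of quadratic forms in normal vectors -/

section

variable {n : ℕ}

lemma quadForm_continuous (A : Matrix (Fin n) (Fin n) ℝ) :
    Continuous fun y : Fin n → ℝ => y ⬝ᵥ (A *ᵥ y) :=
  continuous_id.dotProduct (continuous_const.matrix_mulVec continuous_id)

/-- Two orthogonal quadratic forms in a normal vector, given by projections, the second of which
annihilates the mean, are independent with chi-squared distributions. -/
lemma measurePreserving_quadForms {A B : Matrix (Fin n) (Fin n) ℝ} {k m : ℕ} (hk : k ≠ 0)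
    (hA : Aᵀ = A) (hAA : A * A = A) (hAk : A.trace = k)
    (hB : Bᵀ = B) (hBB : B * B = B) (hBm : B.trace = m) (hAB : A * B = 0)
    {μ : Fin n → ℝ} (hμ : B *ᵥ μ = 0) {σ : ℝ} (hσ : σ ≠ 0) :
    MeasurePreserving
      (fun z => ((μ + σ • z) ⬝ᵥ (A *ᵥ (μ + σ • z)) / σ ^ 2,
        (μ + σ • z) ⬝ᵥ (B *ᵥ (μ + σ • z)) / σ ^ 2))
      (stdNormal (Fin n)) ((noncentralChiSq k (μ ⬝ᵥ (A *ᵥ μ) / σ ^ 2)).prod (chiSq m)) := by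
  obtain ⟨U, hU, hUA⟩ := exists_transpose_mul_eq_of_isProj hA hAA hAk
  obtain ⟨V, hV, hVB⟩ := exists_transpose_mul_eq_of_isProj hB hBB hBm
  have hUV : U * Vᵀ = 0 := by
    have h1 : U * A = U := by rw [← hUA, ← Matrix.mul_assoc, hU, Matrix.one_mul]
    have h2 : B * Vᵀ = Vᵀ := by rw [← hVB, Matrix.mul_assoc, hV, Matrix.mul_one]
    rw [← h1, ← h2, Matrix.mul_assoc, ← Matrix.mul_assoc A, hAB, Matrix.zero_mul, Matrix.mul_zero]
  have hVU : V * Uᵀ = 0 := by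
    have := congrArg transpose hUV
    rwa [transpose_mul, transpose_transpose, transpose_zero] at this
  have hVμ : V *ᵥ μ = 0 := by
    rw [← dotProduct_self_eq_zero, dotProduct_mulVec_self_of_mul_transpose, hVB, hμ,
      dotProduct_zero]
  -- The stacked rows are orthonormal, so `U *ᵥ z` and `V *ᵥ z` are jointly standard normal; this is
  -- where independence comes from.
  have hR : fromRows U V * (fromRows U V)ᵀ = 1 := by
    rw [transpose_fromRows, fromRows_mul_fromCols, hU, hV, hUV, hVU, fromBlocks_one]
  set a := σ⁻¹ • (U *ᵥ μ) with ha
  have haa : a ⬝ᵥ a = μ ⬝ᵥ (A *ᵥ μ) / σ ^ 2 := by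
    rw [ha, smul_dotProduct, dotProduct_smul, dotProduct_mulVec_self_of_mul_transpose, hUA,
      smul_eq_mul, smul_eq_mul]
    field_simp
  have h1 := (measurePreserving_sumPiEquivProdPi
    (fun _ : Fin k ⊕ Fin m => gaussianReal 0 1)).comp (measurePreserving_mulVec hR)
  have h2 : MeasurePreserving (fun z : Fin m → ℝ => z ⬝ᵥ z) (stdNormal (Fin m)) (chiSq m) := by
    have : (fun z : Fin m → ℝ => z ⬝ᵥ z) = fun z => ∑ i, z i ^ 2 := by
      funext z; simp [dotProduct, sq]
    rw [this]
    exact ⟨measurable_sum_sq _, rfl⟩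
  have h3 := ((measurePreserving_sum_sq_add hk a).prod h2).comp h1
  rw [haa] at h3
  convert h3 using 1
  funext z
  have h4 : MeasurableEquiv.sumPiEquivProdPi (fun _ : Fin k ⊕ Fin m => ℝ)
      (fromRows U V *ᵥ z) = (U *ᵥ z, V *ᵥ z) := by
    rw [fromRows_mulVec]; rfl
  simp only [Function.comp_apply, h4, Prod.map_apply, Prod.mk.injEq]
  constructor
  · rw [← hUA, ← dotProduct_mulVec_self_of_mul_transpose]
    have : U *ᵥ (μ + σ • z) = σ • (U *ᵥ z + a) := by
      rw [ha, smul_add, smul_smul, mul_inv_cancel₀ hσ, one_smul, mulVec_add, mulVec_smul, add_comm]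
    rw [this, smul_dotProduct, dotProduct_smul, smul_eq_mul, smul_eq_mul]
    field_simp
  · rw [← hVB, ← dotProduct_mulVec_self_of_mul_transpose, mulVec_add, hVμ, zero_add, mulVec_smul,
      smul_dotProduct, dotProduct_smul, smul_eq_mul, smul_eq_mul]
    field_simp

lemma integral_sq_gaussianReal : ∫ x, x ^ 2 ∂gaussianReal 0 1 = 1 := by
  have h := variance_fun_id_gaussianReal (μ := 0) (v := 1)
  rw [variance_eq_integral (by fun_prop)] at h
  simpa using h

lemma integrable_sq_gaussianReal : Integrable (fun x => x ^ 2) (gaussianReal 0 1) :=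
  (memLp_id_gaussianReal (μ := 0) (v := 1) 2).integrable_sq

lemma integrable_quadForm {A : Matrix (Fin n) (Fin n) ℝ} {r : ℕ} (hA : Aᵀ = A) (hAA : A * A = A)
    (hr : A.trace = r) :
    Integrable (fun z => z ⬝ᵥ (A *ᵥ z)) (stdNormal (Fin n)) ∧
      ∫ z, z ⬝ᵥ (A *ᵥ z) ∂stdNormal (Fin n) = r := by
  obtain ⟨U, hU, hUA⟩ := exists_transpose_mul_eq_of_isProj hA hAA hr
  have h1 := measurePreserving_mulVec hU
  have h2 : (fun z => z ⬝ᵥ (A *ᵥ z)) = (fun w : Fin r → ℝ => ∑ i, w i ^ 2) ∘ fun z => U *ᵥ z := by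
    funext z
    rw [← hUA, ← dotProduct_mulVec_self_of_mul_transpose]
    simp [dotProduct, sq]
  have hi : ∀ i : Fin r, Integrable (fun w : Fin r → ℝ => w i ^ 2) (stdNormal (Fin r)) :=
    fun i => integrable_comp_eval (i := i) (X := fun _ => ℝ) (f := fun x : ℝ => x ^ 2)
      integrable_sq_gaussianReal
  have hint : Integrable (fun w : Fin r → ℝ => ∑ i, w i ^ 2) (stdNormal (Fin r)) :=
    integrable_finsetSum _ fun i _ => hi i
  rw [h2]
  refine ⟨h1.integrable_comp_of_integrable hint, ?_⟩
  rw [h1.hasLaw.integral_comp hint.aestronglyMeasurable, integral_finsetSum _ fun i _ => hi i]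
  have : ∀ i : Fin r, ∫ w : Fin r → ℝ, w i ^ 2 ∂stdNormal (Fin r) = 1 := fun i => by
    rw [← integral_sq_gaussianReal]
    exact integral_comp_eval (i := i) (X := fun _ => ℝ) (μ := fun _ => gaussianReal 0 1)
      (f := fun x : ℝ => x ^ 2) (by fun_prop)
  simp [this]

/-- The error is σHz - (1 - H)μ, noise minus bias, and the two parts are orthogonal, so no cross
term survives even before taking expectations. -/
lemma sq_dist_projection {H : Matrix (Fin n) (Fin n) ℝ} (hH : Hᵀ = H) (hHH : H * H = H)
    (μ z : Fin n → ℝ) (σ : ℝ) :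
    (H *ᵥ (μ + σ • z) - μ) ⬝ᵥ (H *ᵥ (μ + σ • z) - μ) =
      σ ^ 2 * (z ⬝ᵥ (H *ᵥ z)) + μ ⬝ᵥ ((1 - H) *ᵥ μ) := by
  have h1 : H *ᵥ (μ + σ • z) - μ = σ • (H *ᵥ z) - (1 - H) *ᵥ μ := by
    rw [mulVec_add, mulVec_smul, sub_mulVec, one_mulVec]; abel
  have h2 : (H *ᵥ z) ⬝ᵥ ((1 - H) *ᵥ μ) = 0 := by
    rw [← vecMul_transpose, ← dotProduct_mulVec, mulVec_mulVec, hH, Matrix.mul_sub, hHH,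
      Matrix.mul_one, sub_self, zero_mulVec, dotProduct_zero]
  have h3 : (H *ᵥ z) ⬝ᵥ (H *ᵥ z) = z ⬝ᵥ (H *ᵥ z) := by
    rw [dotProduct_mulVec_self_of_mul_transpose, hH, hHH]
  have h4 : ((1 - H) *ᵥ μ) ⬝ᵥ ((1 - H) *ᵥ μ) = μ ⬝ᵥ ((1 - H) *ᵥ μ) := by
    rw [dotProduct_mulVec_self_of_mul_transpose, transpose_sub, transpose_one, hH,
      Matrix.sub_mul, Matrix.mul_sub, Matrix.mul_sub, hHH]
    simp
  rw [h1]
  simp only [sub_dotProduct, dotProduct_sub, smul_dotProduct, dotProduct_smul, smul_eq_mul,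
    dotProduct_comm _ (H *ᵥ z), h2, h3, h4]
  ring

end

/-! ### The regression model: law of the statistic and the risks -/

section

variable {n p : ℕ} {X : Matrix (Fin n) (Fin p) ℝ}

lemma measurePreserving_model (X : Matrix (Fin n) (Fin p) ℝ) (β : Fin p → ℝ) (σ : ℝ) :
    MeasurePreserving (fun z => X *ᵥ β + σ • z) (stdNormal (Fin n)) (modelLaw X β σ) := by
  have h1 : MeasurePreserving (fun (z : Fin n → ℝ) i => σ * z i) (stdNormal (Fin n))
      (Measure.pi fun _ : Fin n => gaussianReal 0 (Real.toNNReal (σ ^ 2))) := by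
    refine measurePreserving_pi (fun _ => gaussianReal 0 1)
      (fun _ => gaussianReal 0 (Real.toNNReal (σ ^ 2))) (f := fun _ z => σ * z)
      fun i => ⟨by fun_prop, ?_⟩
    rw [gaussianReal_map_const_mul, mul_zero, mul_one]
    congr 1
    ext
    simp [Real.coe_toNNReal _ (sq_nonneg σ)]
  have h2 : MeasurePreserving (fun (ε : Fin n → ℝ) i => (X *ᵥ β) i + ε i)
      (Measure.pi fun _ : Fin n => gaussianReal 0 (Real.toNNReal (σ ^ 2)))
      (modelLaw X β σ) := ⟨by fun_prop, rfl⟩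
  exact h2.comp h1

instance (X : Matrix (Fin n) (Fin p) ℝ) (β : Fin p → ℝ) (σ : ℝ) :
    IsProbabilityMeasure (modelLaw X β σ) :=
  Measure.isProbabilityMeasure_map
    (by fun_prop : Measurable fun (ε : Fin n → ℝ) i => (X *ᵥ β) i + ε i).aemeasurable

lemma natCast_ne_zero_of_lt (hpn : p < n) : (n : ℝ) ≠ 0 := by
  have : 0 < n := by omega
  positivity

lemma card_lt_of_ne_univ {S : Finset (Fin p)} (hS : S ≠ Finset.univ) : S.card < p := by
  simpa using Finset.card_lt_card (Finset.ssubset_univ_iff.2 hS)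

lemma hat_mulVec_mean (hG : (Xᵀ * X).PosDef) (β : Fin p → ℝ) : hat X *ᵥ (X *ᵥ β) = X *ᵥ β := by
  rw [mulVec_mulVec, hat_mul (isUnit_det_gram hG)]

variable (S : Finset (Fin p)) (hpn : p < n) (hG : (Xᵀ * X).PosDef)
include hpn hG

lemma gammaTilde_eq (y : Fin n → ℝ) :
    gammaTilde X S y = y ⬝ᵥ ((hat X - hat (subDesign X S)) *ᵥ y) /
      (y ⬝ᵥ ((1 - hat X) *ᵥ y) / ((n : ℝ) - p)) := by
  rw [gammaTilde, gammaTilde_num S hG (natCast_ne_zero_of_lt hpn),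
    sigmaHatSq_eq hG (natCast_ne_zero_of_lt hpn)]

lemma measurable_gammaTilde : Measurable (gammaTilde X S) := by
  rw [funext (gammaTilde_eq S hpn hG)]
  exact (quadForm_continuous _).measurable.div
    ((quadForm_continuous _).measurable.div_const _)

/-- The exact distribution of the statistic. -/
lemma hasLaw_gammaTilde (hS : S ≠ Finset.univ) (β : Fin p → ℝ) {σ : ℝ} (hσ : 0 < σ) :
    HasLaw (gammaTilde X S)
      ((noncentralF (p - S.card) (n - p) (gammaS X S β σ)).map fun f => ((p : ℝ) - S.card) * f)
      (modelLaw X β σ) := by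
  have hc := card_lt_of_ne_univ hS
  have hm := hat_mul_hat (isUnit_det_gram hG)
  have hs := hat_mul_hat (isUnit_det_subGram S hG)
  have h1 := hat_mul_hat_sub S hG
  have h2 := hat_sub_mul_hat S hG
  have hk' : ((p - S.card : ℕ) : ℝ) = (p : ℝ) - S.card := by rw [Nat.cast_sub hc.le]
  have hm' : ((n - p : ℕ) : ℝ) = (n : ℝ) - p := by rw [Nat.cast_sub hpn.le]
  have hlaw := measurePreserving_quadForms (A := hat X - hat (subDesign X S)) (B := 1 - hat X)
    (k := p - S.card) (m := n - p) (by omega)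
    (by rw [transpose_sub, hat_transpose, hat_transpose])
    (by rw [Matrix.sub_mul, Matrix.mul_sub, Matrix.mul_sub, hm, hs, h1, h2]; simp)
    (by rw [trace_sub, trace_hat (isUnit_det_gram hG), trace_hat (isUnit_det_subGram S hG), hk']
        simp)
    (by rw [transpose_sub, transpose_one, hat_transpose])
    (by rw [Matrix.sub_mul, Matrix.mul_sub, Matrix.mul_sub, hm]; simp)
    (by rw [trace_sub, trace_hat (isUnit_det_gram hG), hm']; simp)
    (by rw [Matrix.sub_mul, Matrix.mul_sub, Matrix.mul_sub, hm, h2]; simp)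
    (μ := X *ᵥ β) (by rw [sub_mulVec, hat_mulVec_mean hG, one_mulVec, sub_self])
    hσ.ne'
  -- On the mean Xβ, fixed by H, the projections H - H_S and 1 - H_S act alike.
  have hγ : (X *ᵥ β) ⬝ᵥ ((hat X - hat (subDesign X S)) *ᵥ (X *ᵥ β)) / σ ^ 2 =
      gammaS X S β σ := by
    rw [gammaS_eq S hG (natCast_ne_zero_of_lt hpn), sub_mulVec, hat_mulVec_mean hG, sub_mulVec,
      one_mulVec]
  rw [hγ] at hlaw
  refine ⟨(measurable_gammaTilde S hpn hG).aemeasurable, ?_⟩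
  rw [noncentralF, ← hlaw.map_eq, ← (measurePreserving_model X β σ).map_eq,
    Measure.map_map (measurable_gammaTilde S hpn hG) (measurePreserving_model X β σ).measurable,
    Measure.map_map (by fun_prop) hlaw.measurable,
    Measure.map_map (by fun_prop) ((by fun_prop : Measurable fun w : ℝ × ℝ =>
      (w.1 / ((p - S.card : ℕ) : ℝ)) / (w.2 / ((n - p : ℕ) : ℝ))).comp hlaw.measurable)]
  congr 1
  funext z
  simp only [Function.comp_apply, gammaTilde_eq S hpn hG]
  rw [hk', hm']
  have hk0 : (p : ℝ) - S.card ≠ 0 := by rw [← hk']; exact_mod_cast (by omega : p - S.card ≠ 0)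
  -- σ² and the degrees of freedom cancel. The identity is pointwise: with zero residuals both sides
  -- are 0, since division by zero gives 0.
  field_simp

lemma lossSub_eq (β : Fin p → ℝ) (y : Fin n → ℝ) :
    lossSub X S β y = (n : ℝ)⁻¹ *
      ((hat (subDesign X S) *ᵥ y - X *ᵥ β) ⬝ᵥ (hat (subDesign X S) *ᵥ y - X *ᵥ β)) := by
  rw [← mulVec_betaSub S hG (natCast_ne_zero_of_lt hpn), lossSub, ← Finset.mul_sum]
  simp only [dotProduct, Pi.sub_apply, ← sq]
  rfl

lemma lossWide_eq (β : Fin p → ℝ) (y : Fin n → ℝ) :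
    lossWide X β y = (n : ℝ)⁻¹ *
      ((hat X *ᵥ y - X *ᵥ β) ⬝ᵥ (hat X *ᵥ y - X *ᵥ β)) := by
  rw [← mulVec_betaWide hG (natCast_ne_zero_of_lt hpn), lossWide, ← Finset.mul_sum]
  simp only [dotProduct, Pi.sub_apply, ← sq]
  rfl

omit hpn hG in
lemma integral_sq_dist_projection {H : Matrix (Fin n) (Fin n) ℝ} {r : ℕ} (hH : Hᵀ = H)
    (hHH : H * H = H) (hr : H.trace = r) (β : Fin p → ℝ) (σ : ℝ) :
    Integrable (fun y => (n : ℝ)⁻¹ * ((H *ᵥ y - X *ᵥ β) ⬝ᵥ (H *ᵥ y - X *ᵥ β)))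
      (modelLaw X β σ) ∧
    ∫ y, (n : ℝ)⁻¹ * ((H *ᵥ y - X *ᵥ β) ⬝ᵥ (H *ᵥ y - X *ᵥ β)) ∂modelLaw X β σ =
      (n : ℝ)⁻¹ * (σ ^ 2 * r + (X *ᵥ β) ⬝ᵥ ((1 - H) *ᵥ (X *ᵥ β))) := by
  obtain ⟨h1, h2⟩ := integrable_quadForm hH hHH hr
  have hmp := measurePreserving_model X β σ
  have hcont : Continuous fun y : Fin n → ℝ =>
      (n : ℝ)⁻¹ * ((H *ᵥ y - X *ᵥ β) ⬝ᵥ (H *ᵥ y - X *ᵥ β)) := by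
    have hc : Continuous fun y : Fin n → ℝ => H *ᵥ y - X *ᵥ β :=
      (continuous_const.matrix_mulVec continuous_id).sub continuous_const
    exact continuous_const.mul (hc.dotProduct hc)
  constructor
  · rw [← hmp.integrable_comp hcont.aestronglyMeasurable]
    simp only [Function.comp_def, sq_dist_projection hH hHH]
    exact ((h1.const_mul _).add (integrable_const _)).const_mul _
  · rw [← hmp.hasLaw.integral_comp hcont.aestronglyMeasurable]
    simp only [Function.comp_def, sq_dist_projection hH hHH]
    rw [integral_const_mul, integral_add (h1.const_mul _) (integrable_const _),
      integral_const_mul, h2]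
    simp

lemma risk_sub (β : Fin p → ℝ) {σ : ℝ} (hσ : 0 < σ) :
    Integrable (lossSub X S β) (modelLaw X β σ) ∧
      riskSub X S β σ = (n : ℝ)⁻¹ * σ ^ 2 * (S.card + gammaS X S β σ) := by
  have h := integral_sq_dist_projection (X := X) (hat_transpose (subDesign X S))
    (hat_mul_hat (isUnit_det_subGram S hG)) (trace_hat (isUnit_det_subGram S hG)) β σ
  rw [riskSub, funext (lossSub_eq S hpn hG β)]
  refine ⟨h.1, h.2.trans ?_⟩
  rw [gammaS_eq S hG (natCast_ne_zero_of_lt hpn), Fintype.card_coe]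
  field_simp

lemma risk_wide (β : Fin p → ℝ) (σ : ℝ) :
    Integrable (lossWide X β) (modelLaw X β σ) ∧
      riskWide X β σ = (n : ℝ)⁻¹ * σ ^ 2 * p := by
  have h := integral_sq_dist_projection (X := X) (hat_transpose X)
    (hat_mul_hat (isUnit_det_gram hG)) (trace_hat (isUnit_det_gram hG)) β σ
  rw [riskWide, funext (lossWide_eq hpn hG β)]
  refine ⟨h.1, h.2.trans ?_⟩
  rw [sub_mulVec, hat_mulVec_mean hG, one_mulVec, sub_self, dotProduct_zero, Fintype.card_fin]
  ring

lemma gammaS_nonneg (β : Fin p → ℝ) (σ : ℝ) : 0 ≤ gammaS X S β σ := by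
  rw [gammaS_eq S hG (natCast_ne_zero_of_lt hpn)]
  refine div_nonneg ?_ (sq_nonneg σ)
  have h := dotProduct_mulVec_self_of_mul_transpose (1 - hat (subDesign X S)) (X *ᵥ β)
  rw [transpose_sub, transpose_one, hat_transpose, Matrix.sub_mul, Matrix.mul_sub,
    Matrix.mul_sub, hat_mul_hat (isUnit_det_subGram S hG), Matrix.one_mul, Matrix.mul_one,
    Matrix.one_mul, sub_self, sub_zero] at h
  rw [← h]
  exact Finset.sum_nonneg fun i _ => mul_self_nonneg _

lemma riskWide_pos (hS : S ≠ Finset.univ) (β : Fin p → ℝ) {σ : ℝ} (hσ : 0 < σ) :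
    0 < riskWide X β σ := by
  have hp : 0 < p := (Nat.zero_le _).trans_lt (card_lt_of_ne_univ hS)
  have hn : 0 < n := hp.trans hpn
  rw [(risk_wide hpn hG β σ).2]
  positivity

lemma relRisk_eq (hS : S ≠ Finset.univ) (β : Fin p → ℝ) {σ : ℝ} (hσ : 0 < σ) :
    relRisk X S β σ = (S.card + gammaS X S β σ) / p := by
  have hp : 0 < p := (Nat.zero_le _).trans_lt (card_lt_of_ne_univ hS)
  have hn : 0 < n := hp.trans hpn
  rw [relRisk, (risk_sub S hpn hG β hσ).2, (risk_wide hpn hG β σ).2]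
  field_simp

lemma relRisk_ge (hS : S ≠ Finset.univ) (β : Fin p → ℝ) {σ : ℝ} (hσ : 0 < σ) :
    (S.card : ℝ) / p ≤ relRisk X S β σ := by
  rw [relRisk_eq S hpn hG hS β hσ]
  have := gammaS_nonneg S hpn hG β σ
  gcongr
  linarith

/-! ### The confidence distribution: tail probability, exactness, point mass -/

lemma confDist_relRisk (hS : S ≠ Finset.univ) (β : Fin p → ℝ) {σ : ℝ} (hσ : 0 < σ)
    (y : Fin n → ℝ) :
    confDist X S y (relRisk X S β σ) =
      1 - cdf (noncentralF (p - S.card) (n - p) (gammaS X S β σ))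
        (gammaTilde X S y / ((p : ℝ) - S.card)) := by
  have hp : 0 < p := (Nat.zero_le _).trans_lt (card_lt_of_ne_univ hS)
  rw [confDist, if_pos (relRisk_ge S hpn hG hS β hσ), relRisk_eq S hpn hG hS β hσ]
  have : (p : ℝ) * ((S.card + gammaS X S β σ) / p) - S.card = gammaS X S β σ := by
    field_simp; ring
  rw [this]

/-- The law of the statistic, divided by its numerator degrees of freedom. -/
lemma hasLaw_gammaTilde_div (hS : S ≠ Finset.univ) (β : Fin p → ℝ) {σ : ℝ} (hσ : 0 < σ) :
    HasLaw (fun y => gammaTilde X S y / ((p : ℝ) - S.card))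
      (noncentralF (p - S.card) (n - p) (gammaS X S β σ)) (modelLaw X β σ) := by
  have hc : (0 : ℝ) < (p : ℝ) - S.card :=
    sub_pos.2 (Nat.cast_lt.2 (card_lt_of_ne_univ hS))
  refine ⟨((measurable_gammaTilde S hpn hG).div_const _).aemeasurable, ?_⟩
  have h := (hasLaw_gammaTilde S hpn hG hS β hσ).map_eq
  have h1 := congrArg (Measure.map fun t => t / ((p : ℝ) - S.card)) h
  rw [Measure.map_map (by fun_prop) (measurable_gammaTilde S hpn hG),
    Measure.map_map (by fun_prop) (by fun_prop)] at h1
  refine h1.trans ?_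
  convert Measure.map_id using 2
  funext t
  simp only [Function.comp_apply, id]
  field_simp

/-- One minus the distribution function is a strict tail probability; the F law has no atoms, so the
weak inequality has the same probability. -/
lemma confDist_relRisk_eq_prob (hS : S ≠ Finset.univ) (β : Fin p → ℝ) {σ : ℝ} (hσ : 0 < σ)
    (yobs : Fin n → ℝ) :
    confDist X S yobs (relRisk X S β σ) = (modelLaw X β σ).real
      {y | (S.card + gammaTilde X S yobs) / p ≤ (S.card + gammaTilde X S y) / p} := by
  have hlt := card_lt_of_ne_univ hS
  have hp : (0 : ℝ) < p := Nat.cast_pos.2 ((Nat.zero_le _).trans_lt hlt)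
  have hc : (0 : ℝ) < (p : ℝ) - S.card := sub_pos.2 (Nat.cast_lt.2 hlt)
  set x := gammaTilde X S yobs / ((p : ℝ) - S.card) with hx
  have hset : {y | (S.card + gammaTilde X S yobs) / p ≤ (S.card + gammaTilde X S y) / p} =
      {y | gammaTilde X S y / ((p : ℝ) - S.card) ∈ Ici x} := by
    ext y
    simp only [mem_ofPred_eq, mem_Ici, hx, div_le_div_iff_of_pos_right hp,
      div_le_div_iff_of_pos_right hc, add_le_add_iff_left]
  have : NullSingletonClass (noncentralF (p - S.card) (n - p) (gammaS X S β σ)) :=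
    ⟨noncentralF_singleton (by omega) (by omega) _⟩
  rw [confDist_relRisk S hpn hG hS β hσ, hset,
    (hasLaw_gammaTilde_div S hpn hG hS β hσ).measureReal_eq (p := (· ∈ Ici x)) measurableSet_Ici,
    cdf_eq_real, ← probReal_compl_eq_one_sub measurableSet_Iic, compl_Iic]
  exact measureReal_congr Ioi_ae_eq_Ici

lemma confDist_isExact (hS : S ≠ Finset.univ) :
    IsExactConfidenceDistribution {θ : (Fin p → ℝ) × ℝ | 0 < θ.2}
      (fun θ => modelLaw X θ.1 θ.2) (fun θ => relRisk X S θ.1 θ.2) (confDist X S) where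
  isCdf y := by
    have hlt := card_lt_of_ne_univ hS
    have hp : (0 : ℝ) < p := Nat.cast_pos.2 ((Nat.zero_le _).trans_lt hlt)
    set x := gammaTilde X S y / ((p : ℝ) - S.card)
    have hk : p - S.card ≠ 0 := by omega
    have hm : n - p ≠ 0 := by omega
    have haff : Tendsto (fun r : ℝ => (p : ℝ) * r - S.card) atTop atTop :=
      tendsto_atTop_add_const_right _ _ (tendsto_id.const_mul_atTop hp)
    obtain ⟨μ, hμ, h⟩ := exists_cdf_eq_ite
      (g := fun r => cdf (noncentralF (p - S.card) (n - p) (p * r - S.card)) x)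
      (fun r r' hr => antitone_cdf_noncentralF hk hm x
        (sub_le_sub_right (mul_le_mul_of_nonneg_left hr hp.le) _))
      ((continuous_cdf_noncentralF hk hm x).comp (by fun_prop))
      ((tendsto_cdf_noncentralF hk hm x).comp haff)
      (fun r => cdf_le_one _ _) ((S.card : ℝ) / p)
    refine ⟨μ, hμ, fun r => (h r).trans ?_⟩
    rw [confDist]
  measurable r := by
    simp only [confDist]
    split_ifs
    · have hm : Measurable (cdf (noncentralF (p - S.card) (n - p) (p * r - S.card))) :=
        (cdf _).mono.measurable
      exact measurable_const.sub (hm.comp ((measurable_gammaTilde S hpn hG).div_const _))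
    · exact measurable_const
  exact := by
    rintro ⟨β, σ⟩ hσ α hα
    have hlt := card_lt_of_ne_univ hS
    have hσ' : 0 < σ := hσ
    set μ := noncentralF (p - S.card) (n - p) (gammaS X S β σ)
    -- The true relative risk gives excentre γ_S, so the event says that F, at its own random
    -- argument, is at least 1 - α.
    have hset : {y | confDist X S y (relRisk X S β σ) ≤ α} =
        {y | gammaTilde X S y / ((p : ℝ) - S.card) ∈ {t | 1 - α ≤ cdf μ t}} := by
      ext y
      simp only [mem_ofPred_eq, confDist_relRisk S hpn hG hS β hσ']
      rw [sub_le_comm]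
    have hmeas : MeasurableSet {t | 1 - α ≤ cdf μ t} :=
      measurableSet_le measurable_const (cdf μ).mono.measurable
    dsimp only
    rw [hset, (hasLaw_gammaTilde_div S hpn hG hS β hσ').measure_eq
      (p := (· ∈ {t | 1 - α ≤ cdf μ t})) hmeas]
    refine (measure_le_cdf μ (noncentralF_singleton (by omega) (by omega) _)
      (u := 1 - α) ⟨by linarith [hα.2], by linarith [hα.1]⟩).trans ?_
    rw [sub_sub_cancel]

omit hG in
lemma confDist_pointMass (hS : S ≠ Finset.univ) (yobs : Fin n → ℝ) (μ : Measure ℝ)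
    [IsProbabilityMeasure μ] (h : ∀ r, cdf μ r = confDist X S yobs r) :
    0 < μ.real {(S.card : ℝ) / p} ∧
      μ.real {(S.card : ℝ) / p} = 1 - cdf (centralF (p - S.card) (n - p))
        (gammaTilde X S yobs / ((p : ℝ) - S.card)) := by
  have hlt := card_lt_of_ne_univ hS
  have hp : (0 : ℝ) < p := Nat.cast_pos.2 ((Nat.zero_le _).trans_lt hlt)
  have h1 : μ.real {(S.card : ℝ) / p} = 1 - cdf (centralF (p - S.card) (n - p))
      (gammaTilde X S yobs / ((p : ℝ) - S.card)) := by
    -- At r = |S|/p the excentre p r - |S| is zero, so the jump from 0 is a central F tail.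
    rw [measureReal_singleton_of_cdf fun r hr => by
      rw [h, confDist, if_neg (not_le.2 hr)], h, confDist, if_pos le_rfl,
      mul_div_cancel₀ _ hp.ne', sub_self, noncentralF_zero]
  refine ⟨?_, h1⟩
  rw [h1, ← noncentralF_zero]
  exact sub_pos.2 (cdf_noncentralF_lt_one (by omega) (by omega) _ _)

end

end Afric

theorem mainTheorem5 {n p : ℕ} (hpn : p < n) (X : Matrix (Fin n) (Fin p) ℝ)
    (hX : (Afric.sigmaN X).rank = p) (S : Finset (Fin p)) (hS : S ≠ Finset.univ) :
    -- the exact distribution of the statistic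
    (∀ (β : Fin p → ℝ) (σ : ℝ), 0 < σ →
      HasLaw (Afric.gammaTilde X S)
        ((Afric.noncentralF (p - S.card) (n - p) (Afric.gammaS X S β σ)).map
          fun f => ((p : ℝ) - S.card) * f)
        (Afric.modelLaw X β σ)) ∧
    -- the overall relative risk is well defined, at least `|S|/p`, and governed by `γ_S`
    (∀ (β : Fin p → ℝ) (σ : ℝ), 0 < σ →
      Integrable (Afric.lossSub X S β) (Afric.modelLaw X β σ) ∧
      Integrable (Afric.lossWide X β) (Afric.modelLaw X β σ) ∧
      0 < Afric.riskWide X β σ ∧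
      (S.card : ℝ) / p ≤ Afric.relRisk X S β σ ∧
      Afric.relRisk X S β σ = (S.card + Afric.gammaS X S β σ) / p) ∧
    -- `C*_S` at the true relative risk is the probability of exceeding the observed statistic
    (∀ (β : Fin p → ℝ) (σ : ℝ), 0 < σ → ∀ yobs : Fin n → ℝ,
      Afric.confDist X S yobs (Afric.relRisk X S β σ) =
        (Afric.modelLaw X β σ).real
          {y | (S.card + Afric.gammaTilde X S yobs) / p ≤
            (S.card + Afric.gammaTilde X S y) / p}) ∧
    -- `C*_S` is an exact confidence distribution for the overall relative risk
    Afric.IsExactConfidenceDistribution {θ : (Fin p → ℝ) × ℝ | 0 < θ.2}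
      (fun θ => Afric.modelLaw X θ.1 θ.2) (fun θ => Afric.relRisk X S θ.1 θ.2)
      (Afric.confDist X S) ∧
    -- its point mass at `|S|/p`
    (∀ (yobs : Fin n → ℝ) (μ : Measure ℝ), IsProbabilityMeasure μ →
      (∀ r, cdf μ r = Afric.confDist X S yobs r) →
        0 < μ.real {(S.card : ℝ) / p} ∧
        μ.real {(S.card : ℝ) / p} =
          1 - cdf (Afric.centralF (p - S.card) (n - p))
            (Afric.gammaTilde X S yobs / ((p : ℝ) - S.card))) := by
  have hG := Afric.posDef_gram_of_rank hX
  refine ⟨fun β σ hσ => Afric.hasLaw_gammaTilde S hpn hG hS β hσ, fun β σ hσ => ?_,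
    fun β σ hσ yobs => Afric.confDist_relRisk_eq_prob S hpn hG hS β hσ yobs,
    Afric.confDist_isExact S hpn hG hS,
    fun yobs μ hμ h => Afric.confDist_pointMass S hpn hS yobs μ h⟩
  exact ⟨(Afric.risk_sub S hpn hG β hσ).1, (Afric.risk_wide hpn hG β σ).1,
    Afric.riskWide_pos S hpn hG hS β hσ, Afric.relRisk_ge S hpn hG hS β hσ,
    Afric.relRisk_eq S hpn hG hS β hσ⟩
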